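/- Let $d\ge 1$, $\alpha>0$, $\delta>0$. Let $\{a_n\}_{n\in\mathbb Z^d}$ be non-negative real numbers with $a_n=O(|n|^{-\alpha})$ as $|n|\to\infty$, where $|n|=\|n\|_\infty$. Let $\{\omega_n\}_{n\in\mathbb Z^d}$ be independent, identically distributed real random variables on a probability space $(\Omega,\mathcal B,\mathbb P)$ whose common distribution $\mu$ is absolutely continuous with a density satisfying $\frac{d\mu}{dx}(x)=O\big(|x|^{-(1+\delta)}\big)$ as $|x|\to\infty$. Consider on $L^2(\mathbb R^d)$ the operator $$H^\omega=-\Delta+V^\omega,\qquad V^\omega(x)=\sum_{n\in\mathbb Z^d}a_n\,\omega_n\,\chi_{(0,1]^d}(x-n),$$ with domain $C_c^\infty(\mathbb R^d)$. If $(2+\alpha)\delta>d$, then $H^\omega$ is essentially self-adjoint for almost every $\omega$. -/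

import Mathlib

open MeasureTheory ProbabilityTheory Filter Asymptotics

noncomputable section

open scoped Distributions

/-! ### Essential self-adjointness of unbounded operators -/

/-- A partially defined operator on a Hilbert space is essentially self-adjoint if it is densely
defined, symmetric, and its closure (the closure of its graph) is self-adjoint. -/
def LinearPMap.IsEssentiallySelfAdjoint {H : Type*} [NormedAddCommGroup H]
    [InnerProductSpace ℂ H] [CompleteSpace H] (T : H →ₗ.[ℂ] H) : Prop :=
  Dense (T.domain : Set H) ∧ T.IsFormalAdjoint T ∧ T.IsClosable ∧ IsSelfAdjoint T.closure

namespace RandomSchrodinger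

/-- The Hilbert space `L²(ℝ^d)` of complex valued functions, with Lebesgue measure. -/
abbrev L2 (d : ℕ) : Type := Lp ℂ 2 (volume : Measure (EuclideanSpace ℝ (Fin d)))

/-- The space `C_c^∞(ℝ^d)` of complex valued smooth functions with compact support. -/
abbrev CcInfty (d : ℕ) : Type := 𝓓((⊤ : TopologicalSpace.Opens (EuclideanSpace ℝ (Fin d))), ℂ)

variable {d : ℕ}

theorem memLp_ccInfty (f : CcInfty d) :
    MemLp (f : EuclideanSpace ℝ (Fin d) → ℂ) 2 volume :=
  f.continuous.memLp_of_hasCompactSupport f.hasCompactSupport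

/-- The inclusion `C_c^∞(ℝ^d) → L²(ℝ^d)`. -/
def toL2 (d : ℕ) : CcInfty d →ₗ[ℂ] L2 d where
  toFun f := (memLp_ccInfty f).toLp f
  map_add' f g := (memLp_ccInfty f).toLp_add (memLp_ccInfty g)
  map_smul' c f := (memLp_ccInfty f).toLp_const_smul c

theorem toL2_injective (d : ℕ) : Function.Injective (toL2 d) := by
  intro f g h
  have h1 : (f : EuclideanSpace ℝ (Fin d) → ℂ) =ᵐ[volume] g :=
    (MemLp.toLp_eq_toLp_iff (memLp_ccInfty f) (memLp_ccInfty g)).1 h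
  exact DFunLike.coe_injective ((f.continuous.ae_eq_iff_eq volume g.continuous).1 h1)

/-! ### The operator `-Δ + V` on `C_c^∞(ℝ^d)` -/

/-- `V` is (Borel) measurable and bounded on every compact set. -/
def IsLocallyBoundedPotential (V : EuclideanSpace ℝ (Fin d) → ℝ) : Prop :=
  Measurable V ∧ ∀ K : Set (EuclideanSpace ℝ (Fin d)), IsCompact K → ∃ C, ∀ x ∈ K, |V x| ≤ C

/-- The function `-Δ f + V f`. -/
def schrodingerFun (V : EuclideanSpace ℝ (Fin d) → ℝ) (f : CcInfty d) :
    EuclideanSpace ℝ (Fin d) → ℂ :=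
  fun x => -(Laplacian.laplacian (f : EuclideanSpace ℝ (Fin d) → ℂ) x) + (V x : ℂ) * f x

theorem two_le_smooth : (2 : WithTop ℕ∞) ≤ ((⊤ : ℕ∞) : WithTop ℕ∞) :=
  WithTop.coe_le_coe.2 (le_top : (2 : ℕ∞) ≤ ⊤)

theorem schrodingerFun_add (V : EuclideanSpace ℝ (Fin d) → ℝ) (f g : CcInfty d) :
    schrodingerFun V (f + g) = schrodingerFun V f + schrodingerFun V g := by
  funext x
  have hf : ContDiffAt ℝ 2 f x := (f.contDiff.of_le two_le_smooth).contDiffAt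
  have hg : ContDiffAt ℝ 2 g x := (g.contDiff.of_le two_le_smooth).contDiffAt
  simp only [schrodingerFun, Pi.add_apply, FunLike.coe_add, hf.laplacian_add hg]
  ring

theorem schrodingerFun_smul (V : EuclideanSpace ℝ (Fin d) → ℝ) (c : ℂ) (f : CcInfty d) :
    schrodingerFun V (c • f) = c • schrodingerFun V f := by
  funext x
  have hf : ContDiffAt ℝ 2 f x := (f.contDiff.of_le two_le_smooth).contDiffAt
  simp only [schrodingerFun, Pi.smul_apply, FunLike.coe_smul,
    InnerProductSpace.laplacian_smul c hf, smul_eq_mul]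
  ring

theorem memLp_schrodingerFun {V : EuclideanSpace ℝ (Fin d) → ℝ}
    (hV : IsLocallyBoundedPotential V) (f : CcInfty d) :
    MemLp (schrodingerFun V f) 2 volume := by
  have h1 : MemLp (Laplacian.laplacian (f : EuclideanSpace ℝ (Fin d) → ℂ)) 2 volume := by
    have hc : ContDiff ℝ 2 f := f.contDiff.of_le two_le_smooth
    have h2 := hc.continuous_iteratedFDeriv (m := 2) le_rfl
    rw [InnerProductSpace.laplacian_eq_iteratedFDeriv_stdOrthonormalBasis]
    apply memLp_finsetSum
    intro i _
    have hs := f.hasCompactSupport.iteratedFDeriv (𝕜 := ℝ) 2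
    refine Continuous.memLp_of_hasCompactSupport (by fun_prop) ?_
    exact hs.comp_left (g := fun L => L ![(stdOrthonormalBasis ℝ (EuclideanSpace ℝ (Fin d))) i,
      (stdOrthonormalBasis ℝ (EuclideanSpace ℝ (Fin d))) i]) (by simp)
  obtain ⟨C, hC⟩ := hV.2 _ f.hasCompactSupport
  have h2 : MemLp (fun x => (V x : ℂ) * f x) 2 volume := by
    refine (memLp_ccInfty f).of_le_mul (c := C) ?_ ?_
    · exact ((Complex.measurable_ofReal.comp hV.1).mul
        f.continuous.measurable).aestronglyMeasurable
    · refine Eventually.of_forall fun x => ?_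
      by_cases hx : x ∈ tsupport f
      · rw [norm_mul, Complex.norm_real]
        exact mul_le_mul_of_nonneg_right (hC x hx) (norm_nonneg _)
      · simp [image_eq_zero_of_notMem_tsupport hx]
  exact h1.neg.add h2

/-- `f ↦ -Δ f + V f` as a linear map from `C_c^∞(ℝ^d)` to `L²(ℝ^d)`. -/
def schrodingerLin (V : EuclideanSpace ℝ (Fin d) → ℝ) (hV : IsLocallyBoundedPotential V) :
    CcInfty d →ₗ[ℂ] L2 d where
  toFun f := (memLp_schrodingerFun hV f).toLp (schrodingerFun V f)
  map_add' f g := by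
    rw [← MemLp.toLp_add]
    simp only [schrodingerFun_add]
  map_smul' c f := by
    rw [RingHom.id_apply, ← MemLp.toLp_const_smul]
    simp only [schrodingerFun_smul]

/-- The Schrödinger operator `-Δ + V` in `L²(ℝ^d)` with domain `C_c^∞(ℝ^d)`. -/
def schrodingerOp (V : EuclideanSpace ℝ (Fin d) → ℝ) (hV : IsLocallyBoundedPotential V) :
    L2 d →ₗ.[ℂ] L2 d where
  domain := LinearMap.range (toL2 d)
  toFun := (schrodingerLin V hV).comp
    (LinearEquiv.ofInjective (toL2 d) (toL2_injective d)).symm.toLinearMap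

theorem schrodingerOp_apply (V : EuclideanSpace ℝ (Fin d) → ℝ)
    (hV : IsLocallyBoundedPotential V) (f : CcInfty d) :
    schrodingerOp V hV ⟨toL2 d f, LinearMap.mem_range_self (toL2 d) f⟩ =
      (memLp_schrodingerFun hV f).toLp (schrodingerFun V f) := by
  have : (LinearEquiv.ofInjective (toL2 d) (toL2_injective d)).symm
      ⟨toL2 d f, LinearMap.mem_range_self (toL2 d) f⟩ = f := by
    rw [LinearEquiv.symm_apply_eq]
    rfl
  exact congrArg (schrodingerLin V hV) this

/-! ### The random potential -/

/-- The cube `(0,1]^d`. -/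
def unitCube (d : ℕ) : Set (EuclideanSpace ℝ (Fin d)) := {x | ∀ i, 0 < x i ∧ x i ≤ 1}

/-- The point of `ℝ^d` with the integer coordinates `n`. -/
def latticePoint (n : Fin d → ℤ) : EuclideanSpace ℝ (Fin d) := WithLp.toLp 2 fun i => (n i : ℝ)

/-- The potential `V(x) = ∑_{n ∈ ℤ^d} a_n w_n χ_{(0,1]^d}(x - n)`, for a realization `w` of the
random variables. At each `x` exactly one term has a nonzero indicator. -/
def potential (a w : (Fin d → ℤ) → ℝ) (x : EuclideanSpace ℝ (Fin d)) : ℝ :=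
  ∑' n : Fin d → ℤ, a n * w n * (unitCube d).indicator (fun _ => (1 : ℝ)) (x - latticePoint n)

/-- The index of the cube that contains `x`. -/
def cellIndex (x : EuclideanSpace ℝ (Fin d)) : Fin d → ℤ := fun i => ⌈x i⌉ - 1

theorem sub_latticePoint_mem_unitCube (x : EuclideanSpace ℝ (Fin d)) (n : Fin d → ℤ) :
    x - latticePoint n ∈ unitCube d ↔ n = cellIndex x := by
  simp only [unitCube, latticePoint, cellIndex, Set.mem_ofPred_eq, PiLp.sub_apply, funext_iff]
  refine forall_congr' fun i => ?_
  constructor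
  · rintro ⟨h1, h2⟩
    have : ⌈x i⌉ = n i + 1 := by
      rw [Int.ceil_eq_iff]
      push_cast
      constructor <;> linarith
    omega
  · intro h
    rw [h]
    push_cast
    constructor
    · linarith [Int.ceil_lt_add_one (x i)]
    · linarith [Int.le_ceil (x i)]

theorem potential_eq (a w : (Fin d → ℤ) → ℝ) (x : EuclideanSpace ℝ (Fin d)) :
    potential a w x = a (cellIndex x) * w (cellIndex x) := by
  unfold potential
  rw [tsum_eq_single (cellIndex x)]
  · rw [Set.indicator_of_mem ((sub_latticePoint_mem_unitCube x _).2 rfl), mul_one]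
  · intro n hn
    rw [Set.indicator_of_notMem (fun h => hn ((sub_latticePoint_mem_unitCube x n).1 h)), mul_zero]

theorem isLocallyBoundedPotential_potential (a w : (Fin d → ℤ) → ℝ) :
    IsLocallyBoundedPotential (potential a w) := by
  have he : potential a w = (fun n => a n * w n) ∘ cellIndex := funext (potential_eq a w)
  constructor
  · rw [he]
    refine (Measurable.of_discrete (f := fun n : Fin d → ℤ => a n * w n)).comp ?_
    unfold cellIndex
    refine measurable_pi_lambda _ fun i => ?_
    exact (Int.measurable_ceil.comp (by fun_prop)).sub_const 1
  · intro K hK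
    obtain ⟨R, hR⟩ := hK.isBounded.exists_norm_le
    have hfin : (Set.Icc (fun _ => ⌈-R⌉ - 1 : Fin d → ℤ) (fun _ => ⌈R⌉ - 1)).Finite :=
      Set.finite_Icc _ _
    obtain ⟨C, hC⟩ := (hfin.image fun n => |a n * w n|).bddAbove
    refine ⟨C, fun x hx => ?_⟩
    rw [potential_eq]
    refine hC ⟨cellIndex x, ⟨fun i => ?_, fun i => ?_⟩, rfl⟩ <;>
      have h1 := abs_le.1 ((PiLp.norm_apply_le x i).trans (hR x hx))
    · exact sub_le_sub_right (Int.ceil_mono h1.1) 1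
    · exact sub_le_sub_right (Int.ceil_mono h1.2) 1

/-- The operator `-Δ + ∑ₙ aₙ wₙ χ_{(0,1]^d}(· - n)` in `L²(ℝ^d)` with domain `C_c^∞(ℝ^d)`, for a
realization `w` of the random variables. -/
def hamiltonian (a w : (Fin d → ℤ) → ℝ) : L2 d →ₗ.[ℂ] L2 d :=
  schrodingerOp (potential a w) (isLocallyBoundedPotential_potential a w)

/-- `μ` is absolutely continuous with a density `ρ(x) = O(|x|^{-(1+δ)})` as `|x| → ∞`. -/
def HasTailDensity (δ : ℝ) (μ : Measure ℝ) : Prop :=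
  ∃ ρ : ℝ → ℝ, Measurable ρ ∧ (∀ x, 0 ≤ ρ x) ∧
    μ = volume.withDensity (fun x => ENNReal.ofReal (ρ x)) ∧
    ρ =O[Bornology.cobounded ℝ] fun x => |x| ^ (-(1 + δ))

end RandomSchrodinger

end

/-! ### Essential self-adjointness from reality of the adjoint's quadratic form. -/

section SelfAdjointCriterion

variable {H : Type*} [NormedAddCommGroup H] [InnerProductSpace ℂ H]

open scoped ComplexConjugate

/-! Almost surely the potential grows at most quadratically, and `-Δ + V` is essentially
self-adjoint for every measurable real `V` of at most quadratic growth.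

Growth: up to constants, `|aₙ ωₙ| > ‖n‖²` forces `|ωₙ|` above `‖n‖^(2+α)`, an event of probability
`O(‖n‖^(-(2+α)δ))`. These bounds are summable over `ℤ^d` because `(2+α)δ > d`, so Borel–Cantelli
leaves finitely many exceptional sites (`ae_exists_abs_mul_le`).

Self-adjointness: by `LinearPMap.isEssentiallySelfAdjoint_of_im_inner_eq_zero` it suffices that `⟪ψ,
φ⟫` is real whenever `-Δψ + Vψ = φ` weakly with `ψ, φ ∈ L²`. Pair the equation with `iηψ`, where `η`
is a cutoff at scale `R`. As `V` is real it drops out, and a flux through the support of `∇η`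
remains. The flux is bounded by the mass of `ψ` outside the ball of radius `R` and by `∫ ζ|∇ψ|²`,
where `ζ = |∇η|² = O(R⁻²)`; a second integration by parts bounds the latter by that mass and `∫
ζ²|Δψ|²`. Since `Δψ = Vψ - φ` is at most of order `R²(|ψ| + |φ|)` where `ζ ≠ 0`, the factor `ζ²`
absorbs the growth, and everything is a tail of an integrable function
(`IsWeakNegSumSecondDeriv.integral_inner_I_mul_eq_zero`). The inequality is proved for smooth
functions and carried to weak solutions by mollification
(`IsWeakNegSumSecondDeriv.abs_integral_mul_inner_I_le`). -/

/-- A subspace of `H × H` on which `⟪x, y⟫` is real consists of pairs that are symmetric with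
respect to each other. -/
theorem Submodule.inner_snd_eq_of_im_inner_eq_zero (G : Submodule ℂ (H × H))
    (hG : ∀ p ∈ G, (inner ℂ p.1 p.2).im = 0) {p q : H × H} (hp : p ∈ G) (hq : q ∈ G) :
    inner ℂ p.2 q.1 = inner ℂ p.1 q.2 := by
  -- Polarization: `p + q` yields the imaginary part of the identity and `p + iq` the real part.
  have h1 := hG _ (G.add_mem hp hq)
  have h2 := hG _ (G.add_mem hp (G.smul_mem Complex.I hq))
  have hp' := hG _ hp
  have hq' := hG _ hq
  have hpq : inner ℂ q.1 p.2 = conj (inner ℂ p.2 q.1) := (inner_conj_symm _ _).symm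
  simp only [Prod.fst_add, Prod.snd_add, Prod.smul_fst, Prod.smul_snd, inner_add_left,
    inner_add_right, inner_smul_left, inner_smul_right, hpq] at h1 h2
  simp only [Complex.add_im, Complex.add_re, Complex.mul_im, Complex.mul_re, Complex.conj_im,
    Complex.conj_re,
    Complex.I_re, Complex.I_im, hp', hq'] at h1 h2
  apply Complex.ext <;> linarith

/-- Up to the rotation `(x, y) ↦ (y, -x)`, `G.adjoint` is the orthogonal complement of `G`, so the
hypothesis says `p ∈ Gᗮᗮ`. `WithLp 2` supplies the Hilbert structure, with the same topology as `H ×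
H`. -/
theorem Submodule.mem_topologicalClosure_of_forall_adjoint [CompleteSpace H]
    (G : Submodule ℂ (H × H)) (p : H × H)
    (hp : ∀ q ∈ G.adjoint, inner ℂ p.2 q.1 = inner ℂ p.1 q.2) : p ∈ G.topologicalClosure := by
  let e : WithLp 2 (H × H) ≃L[ℂ] H × H := WithLp.prodContinuousLinearEquiv 2 ℂ H H
  let K : Submodule ℂ (WithLp 2 (H × H)) := G.comap e.toLinearEquiv.toLinearMap
  have h1 : e.symm p ∈ Kᗮᗮ := by
    rw [Submodule.mem_orthogonal']
    intro q hq
    rw [Submodule.mem_orthogonal] at hq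
    have h2 : ((q.snd, -q.fst) : H × H) ∈ G.adjoint := by
      rw [Submodule.mem_adjoint_iff]
      intro a b hab
      have := hq (WithLp.toLp 2 (a, b)) hab
      rw [WithLp.prod_inner_apply] at this
      simp only [inner_neg_right, sub_neg_eq_add]
      rw [add_comm]
      exact this
    have h3 := hp _ h2
    rw [WithLp.prod_inner_apply]
    simp only [inner_neg_right] at h3
    change inner ℂ p.1 q.fst + inner ℂ p.2 q.snd = 0
    rw [h3]
    ring
  rw [Submodule.orthogonal_orthogonal_eq_closure] at h1
  have h4 : e.symm p ∈ closure (e ⁻¹' (G : Set (H × H))) := h1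
  have h5 : e ⁻¹' closure (G : Set (H × H)) = closure (e ⁻¹' (G : Set (H × H))) :=
    e.toHomeomorph.preimage_closure _
  rw [← h5] at h4
  rw [Set.mem_preimage, e.apply_symm_apply] at h4
  exact h4

/-- A densely defined symmetric operator is essentially self-adjoint if its adjoint `T†` satisfies
`⟪x, T† x⟫ ∈ ℝ` on its domain. -/
theorem LinearPMap.isEssentiallySelfAdjoint_of_im_inner_eq_zero [CompleteSpace H]
    {T : H →ₗ.[ℂ] H} (hd : Dense (T.domain : Set H)) (hs : T.IsFormalAdjoint T)
    (h : ∀ x y : H, (∀ z : T.domain, inner ℂ (T z) x = inner ℂ (z : H) y) →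
      (inner ℂ x y).im = 0) :
    T.IsEssentiallySelfAdjoint := by
  have hle : T ≤ T.adjoint := hs.le_adjoint hd
  have hcl : T.IsClosable := (LinearPMap.adjoint_isClosed hd).isClosable.leIsClosable hle
  refine ⟨hd, hs, hcl, ?_⟩
  have hd' : Dense (T.closure.domain : Set H) := hd.mono T.le_closure.1
  have hmem : ∀ x y : H, (x, y) ∈ T.graph.adjoint ↔
      ∀ z : T.domain, inner ℂ (T z) x = inner ℂ (z : H) y := by
    intro x y
    rw [Submodule.mem_adjoint_iff]
    constructor
    · exact fun hxy z => sub_eq_zero.1 (hxy _ _ (T.mem_graph z))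
    · intro hxy a b hab
      obtain ⟨z, rfl, rfl⟩ := (LinearPMap.mem_graph_iff T).1 hab
      exact sub_eq_zero.2 (hxy z)
  have hsymm : ∀ p ∈ T.graph.adjoint, ∀ q ∈ T.graph.adjoint,
      inner ℂ p.2 q.1 = inner ℂ p.1 q.2 := fun p hp q hq =>
    Submodule.inner_snd_eq_of_im_inner_eq_zero _
      (fun r hr => h r.1 r.2 ((hmem r.1 r.2).1 hr)) hp hq
  -- The crux: symmetry of the adjoint relation places it inside the closure of `T.graph`; the
  -- reverse inclusion holds because the adjoint is a closed extension of `T`.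
  have hgraph : T.graph.adjoint = T.graph.topologicalClosure := by
    apply le_antisymm
    · exact fun p hp => Submodule.mem_topologicalClosure_of_forall_adjoint _ p (hsymm p hp)
    · rw [← LinearPMap.adjoint_graph_eq_graph_adjoint hd]
      exact Submodule.topologicalClosure_minimal _ (LinearPMap.le_graph_of_le hle)
        (LinearPMap.adjoint_isClosed hd)
  rw [LinearPMap.isSelfAdjoint_def]
  apply LinearPMap.eq_of_eq_graph
  rw [LinearPMap.adjoint_graph_eq_graph_adjoint hd', ← hcl.graph_closure_eq_closure_graph,
    ← hgraph]
  -- With `G = T.graph` the goal is now `G** = G*`: dualizing `G ≤ G*` gives one inclusion, symmetry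
  -- of `G*` the other.
  apply le_antisymm
  · rintro ⟨x, y⟩ hp
    rw [Submodule.mem_adjoint_iff] at hp ⊢
    intro a b hab
    exact hp a b (hgraph ▸ Submodule.le_topologicalClosure _ hab)
  · rintro ⟨x, y⟩ hp
    rw [Submodule.mem_adjoint_iff]
    exact fun a b hab => sub_eq_zero.2 (hsymm _ hab _ hp)

end SelfAdjointCriterion

/-! ### Almost sure quadratic growth of the potential. -/

section

open scoped ENNReal

/-- `∑_{n ∈ ℤ^d} ‖n‖^r` converges for `r < -d`. -/
theorem summable_norm_rpow_intLattice {d : ℕ} {r : ℝ} (hr : r < -d) :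
    Summable fun n : Fin d → ℤ => ‖n‖ ^ r := by
  let b := Pi.basisFun ℝ (Fin d)
  let L : Submodule ℤ (Fin d → ℝ) := Submodule.span ℤ (Set.range b)
  have hL : Module.finrank ℤ L = d := by
    have : Module.finrank ℤ L = Module.finrank ℝ (Fin d → ℝ) := ZLattice.rank ℝ L
    simpa using this
  have h := ZLattice.summable_norm_rpow L r (by rwa [hL])
  have hmem : ∀ n : Fin d → ℤ, (fun i => (n i : ℝ)) ∈ L := by
    intro n
    rw [Module.Basis.mem_span_iff_repr_mem]
    intro i
    exact ⟨n i, by simp [b]⟩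
  let φ : (Fin d → ℤ) → L := fun n => ⟨fun i => (n i : ℝ), hmem n⟩
  have hφ : Function.Injective φ := by
    intro m n hmn
    have h1 : (fun i => (m i : ℝ)) = fun i => (n i : ℝ) := congrArg Subtype.val hmn
    funext i
    exact_mod_cast congrFun h1 i
  refine (h.comp_injective hφ).congr fun n => ?_
  have hn : ‖φ n‖ = ‖n‖ := by
    change ‖fun i => (n i : ℝ)‖ = ‖n‖
    simp only [Pi.norm_def]
    congr 2
  rw [← hn]
  rfl

namespace RandomSchrodinger

/-- Integrating the density bound over each half-line gives `C / δ * t ^ (-δ)`; the two half-lines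
double the constant. -/
theorem HasTailDensity.exists_measure_le {δ : ℝ} (hδ : 0 < δ) {μ : Measure ℝ}
    (hμ : HasTailDensity δ μ) :
    ∃ C ≥ (0 : ℝ), ∃ t₀ > (0 : ℝ), ∀ t ≥ t₀,
      μ {x | t < |x|} ≤ ENNReal.ofReal (C * t ^ (-δ)) := by
  obtain ⟨ρ, hm, h0, rfl, hO⟩ := hμ
  obtain ⟨C, hCpos, hC⟩ := hO.exists_pos
  rw [isBigOWith_iff] at hC
  rw [← comap_norm_atTop, eventually_comap, eventually_atTop] at hC
  obtain ⟨t₀, ht₀⟩ := hC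
  refine ⟨2 * C / δ, by positivity, max t₀ 1, by positivity, fun t ht => ?_⟩
  have ht1 : t₀ ≤ t := (le_max_left _ _).trans ht
  have htpos : 0 < t := lt_of_lt_of_le (by positivity) ht
  have hset : {x : ℝ | t < |x|} = Set.Ioi t ∪ Set.Iio (-t) := by
    ext x
    simp only [Set.mem_ofPred_eq, Set.mem_union, Set.mem_Ioi, Set.mem_Iio, lt_abs]
    constructor <;> rintro (h | h) <;> first | (left; linarith) | (right; linarith)
  have hbound : ∀ x : ℝ, t < |x| → ρ x ≤ C * |x| ^ (-(1 + δ)) := by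
    intro x hx
    have := ht₀ |x| (ht1.trans hx.le) x rfl
    rwa [Real.norm_of_nonneg (h0 x), Real.norm_of_nonneg (by positivity)] at this
  have hI : ∫⁻ x in Set.Ioi t, ENNReal.ofReal (C * x ^ (-(1 + δ))) =
      ENNReal.ofReal (C / δ * t ^ (-δ)) := by
    rw [← ofReal_integral_eq_lintegral_ofReal]
    · congr 1
      rw [integral_const_mul, integral_Ioi_rpow_of_lt (by linarith) htpos]
      rw [show -(1 + δ) + 1 = -δ by ring]
      field_simp
    · exact (integrableOn_Ioi_rpow_of_lt (by linarith) htpos).const_mul C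
    · refine (ae_restrict_iff' measurableSet_Ioi).2 (Eventually.of_forall fun x hx => ?_)
      have : 0 < x := htpos.trans hx
      positivity
  have h1 : ∫⁻ x in Set.Ioi t, ENNReal.ofReal (ρ x) ≤ ENNReal.ofReal (C / δ * t ^ (-δ)) := by
    rw [← hI]
    refine setLIntegral_mono' measurableSet_Ioi fun x hx => ENNReal.ofReal_le_ofReal ?_
    have hx' : 0 < x := htpos.trans hx
    simpa [abs_of_pos hx'] using hbound x (by rwa [abs_of_pos hx'])
  have h2 : ∫⁻ x in Set.Iio (-t), ENNReal.ofReal (ρ x) ≤ ENNReal.ofReal (C / δ * t ^ (-δ)) := by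
    have hmp : MeasurePreserving (fun x : ℝ => -x) volume volume := Measure.measurePreserving_neg _
    have hset' : Set.Iio (-t) = (fun x : ℝ => -x) ⁻¹' Set.Ioi t := by
      ext x
      simp
    rw [← hI, ← hmp.setLIntegral_comp_preimage measurableSet_Ioi (by fun_prop), ← hset']
    refine setLIntegral_mono' measurableSet_Iio fun x hx => ENNReal.ofReal_le_ofReal ?_
    have hx' : x < 0 := lt_trans hx (by linarith)
    have hx2 : x < -t := hx
    simpa [abs_of_neg hx'] using hbound x (by rw [abs_of_neg hx']; linarith)
  rw [hset, withDensity_apply _ (by measurability)]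
  refine (lintegral_union_le _ _ _).trans ((add_le_add h1 h2).trans ?_)
  rw [← ENNReal.ofReal_add (by positivity) (by positivity)]
  apply le_of_eq
  congr 1
  ring

/-- Almost surely, the coefficients `aₙ ωₙ` grow at most quadratically. -/
theorem ae_exists_abs_mul_le {d : ℕ} {α δ : ℝ} (hα : 0 < α) (hδ : 0 < δ)
    (hαδ : (d : ℝ) < (2 + α) * δ)
    (a : (Fin d → ℤ) → ℝ)
    (ha : a =O[Bornology.cobounded (Fin d → ℤ)] fun n => ‖n‖ ^ (-α))
    (μ : Measure ℝ) (hμ : HasTailDensity δ μ)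
    {Ω : Type*} [MeasurableSpace Ω] (P : Measure Ω)
    (ω : (Fin d → ℤ) → Ω → ℝ) (hω : ∀ n, Measurable (ω n)) (hω_law : ∀ n, P.map (ω n) = μ) :
    ∀ᵐ θ ∂P, ∃ C, ∀ n, |a n * ω n θ| ≤ C * (1 + ‖n‖ ^ 2) := by
  obtain ⟨A, hA, haA⟩ := ha.exists_pos
  rw [isBigOWith_iff, ← comap_norm_atTop, eventually_comap, eventually_atTop] at haA
  obtain ⟨r₀, hr₀⟩ := haA
  obtain ⟨C, hC, t₀, ht₀, hT⟩ := hμ.exists_measure_le hδ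
  have hlim : Tendsto (fun r : ℝ => r ^ (2 + α) / A) atTop atTop :=
    (tendsto_rpow_atTop (by linarith)).atTop_div_const hA
  obtain ⟨r₁, hr₁⟩ := eventually_atTop.1 (hlim.eventually_ge_atTop t₀)
  set R := max (max r₀ r₁) 1 with hR
  -- Since `|a n| ≤ A ‖n‖ ^ (-α)` far out, avoiding `s n` there means `|a n * ω n θ| ≤ ‖n‖ ^ 2`. The
  -- condition `R ≤ ‖n‖` also excludes `n = 0` and the range where the asymptotic bounds fail.
  let s : (Fin d → ℤ) → Set Ω := fun n => {θ | R ≤ ‖n‖ ∧ ‖n‖ ^ (2 + α) / A < |ω n θ|}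
  have hs : ∀ n, P (s n) ≤ ENNReal.ofReal (C * A ^ δ * ‖n‖ ^ (-((2 + α) * δ))) := by
    intro n
    by_cases hn : R ≤ ‖n‖
    · have hn0 : 0 < ‖n‖ := lt_of_lt_of_le (by positivity) hn
      have hsn : s n = ω n ⁻¹' {x | ‖n‖ ^ (2 + α) / A < |x|} := by
        ext θ
        simp [s, hn]
      have hms : MeasurableSet {x : ℝ | ‖n‖ ^ (2 + α) / A < |x|} :=
        measurableSet_lt measurable_const (by fun_prop)
      rw [hsn, ← Measure.map_apply (hω n) hms, hω_law]
      refine (hT _ (hr₁ _ (((le_max_right _ _).trans (le_max_left _ _)).trans hn))).trans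
        (le_of_eq ?_)
      congr 1
      rw [Real.div_rpow (by positivity) hA.le, ← Real.rpow_mul hn0.le, Real.rpow_neg hA.le,
        mul_neg]
      field_simp
    · have : s n = ∅ := by
        ext θ
        simp [s, hn]
      simp [this]
  -- The exponent condition `(2 + α) * δ > d` enters here; Borel–Cantelli then makes the bad sites
  -- finite in number.
  have hsum : ∑' n, P (s n) ≠ ∞ := by
    refine ne_top_of_le_ne_top ?_ (ENNReal.tsum_le_tsum hs)
    exact ((summable_norm_rpow_intLattice (by linarith)).mul_left _).tsum_ofReal_ne_top
  filter_upwards [ae_finite_setOfPred_mem hsum] with θ hθ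
  have hfin : ({n | θ ∈ s n} ∪ {n : Fin d → ℤ | ‖n‖ < R}).Finite := by
    refine hθ.union ?_
    refine (Metric.finite_isBounded_inter_isClosed DiscreteTopology.isDiscrete
      (Metric.isBounded_ball (x := (0 : Fin d → ℤ)) (r := R)) isClosed_univ).subset ?_
    intro n hn
    simpa using hn
  obtain ⟨B, hB⟩ := (hfin.image fun n => |a n * ω n θ|).bddAbove
  refine ⟨max B 1, fun n => ?_⟩
  by_cases hn : n ∈ {n | θ ∈ s n} ∪ {n : Fin d → ℤ | ‖n‖ < R}
  · have h1 : |a n * ω n θ| ≤ max B 1 := (hB ⟨n, hn, rfl⟩).trans (le_max_left _ _)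
    refine h1.trans (le_mul_of_one_le_right (by positivity) ?_)
    linarith [sq_nonneg ‖n‖]
  · simp only [Set.mem_union, Set.mem_ofPred_eq, not_or, not_lt, s, not_and] at hn
    have hn2 : R ≤ ‖n‖ := hn.2
    have hn0 : 0 < ‖n‖ := lt_of_lt_of_le (by positivity) hn2
    have h1 : |ω n θ| ≤ ‖n‖ ^ (2 + α) / A := hn.1 hn2
    have h2 := hr₀ ‖n‖ (((le_max_left _ _).trans (le_max_left _ _)).trans hn2) n rfl
    rw [Real.norm_eq_abs, Real.norm_of_nonneg (by positivity)] at h2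
    have h3 : |a n * ω n θ| ≤ ‖n‖ ^ 2 := by
      rw [abs_mul]
      refine (mul_le_mul h2 h1 (abs_nonneg _) (by positivity)).trans (le_of_eq ?_)
      rw [Real.rpow_add hn0, Real.rpow_neg hn0.le, Real.rpow_two]
      field_simp
    calc |a n * ω n θ| ≤ 1 * (1 + ‖n‖ ^ 2) := by linarith
      _ ≤ max B 1 * (1 + ‖n‖ ^ 2) := by gcongr; exact le_max_right _ _

/-- If `|aₙ wₙ|` grows at most quadratically in `n`, then so does the potential. -/
theorem exists_abs_potential_le {d : ℕ} {a w : (Fin d → ℤ) → ℝ}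
    (h : ∃ C, ∀ n, |a n * w n| ≤ C * (1 + ‖n‖ ^ 2)) :
    ∃ C ≥ 0, ∀ x, |potential a w x| ≤ C * (1 + ‖x‖ ^ 2) := by
  obtain ⟨C, hC⟩ := h
  have hC0 : 0 ≤ C := by
    have := (abs_nonneg _).trans (hC 0)
    simpa using this
  -- The cell index moves the norm by at most 1, and `1 + (r + 1)² ≤ 3 (1 + r²)`.
  refine ⟨C * 3, by positivity, fun x => ?_⟩
  rw [potential_eq]
  have h1 : ‖cellIndex x‖ ≤ ‖x‖ + 1 := by
    refine (pi_norm_le_iff_of_nonneg (by positivity)).2 fun i => ?_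
    have h2 := abs_le.1 (PiLp.norm_apply_le x i)
    rw [Int.norm_eq_abs, abs_le]
    simp only [cellIndex]
    push_cast
    have h3 := Int.le_ceil (x i)
    have h4 := Int.ceil_lt_add_one (x i)
    constructor <;> linarith
  refine (hC _).trans ?_
  rw [mul_assoc]
  gcongr
  have : ‖cellIndex x‖ ^ 2 ≤ (‖x‖ + 1) ^ 2 := by gcongr
  nlinarith [sq_nonneg (‖x‖ - 1)]

end RandomSchrodinger

end

/-! ### A Caccioppoli-type estimate for smooth functions. -/

section

open scoped RealInnerProductSpace

theorem ContDiff.fderiv_apply_const {E F : Type*} [NormedAddCommGroup E]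
    [NormedSpace ℝ E] [NormedAddCommGroup F] [NormedSpace ℝ F]
    {f : E → F} {n m : WithTop ℕ∞} (hf : ContDiff ℝ n f) (h : m + 1 ≤ n) (v : E) :
    ContDiff ℝ m fun x => fderiv ℝ f x v :=
  (hf.fderiv_right h).clm_apply contDiff_const

section Caccioppoli

variable {E : Type*} [NormedAddCommGroup E] [NormedSpace ℝ E] [FiniteDimensional ℝ E]
  [MeasurableSpace E] [BorelSpace E] {μ : Measure E} [μ.IsAddHaarMeasure]

/-- The sum `∑ᵢ ∂ᵢ∂ᵢ f` of the second derivatives of `f` in the directions `vᵢ`. -/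
noncomputable def sumSecondDeriv {ι F : Type*} [Fintype ι] [NormedAddCommGroup F]
    [NormedSpace ℝ F] (v : ι → E) (f : E → F) (x : E) : F :=
  ∑ i, fderiv ℝ (fun y => fderiv ℝ f y (v i)) x (v i)

/-- Integration by parts against the constant 1. The identities below apply this to suitable
products. -/
theorem integral_fderiv_apply_eq_zero {F : Type*} [NormedAddCommGroup F] [NormedSpace ℝ F]
    {f : E → F} (hf : ContDiff ℝ 1 f) (hc : HasCompactSupport f) (v : E) :
    ∫ x, fderiv ℝ f x v ∂μ = 0 := by
  have hi : Integrable (fun x => fderiv ℝ f x v) μ :=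
    Continuous.integrable_of_hasCompactSupport
      ((hf.continuous_fderiv one_ne_zero).clm_apply continuous_const) (hc.fderiv_apply (𝕜 := ℝ) v)
  have h := integral_smul_fderiv_eq_neg_fderiv_smul_of_integrable (μ := μ) (𝕜 := ℝ)
    (f := fun _ => (1 : ℝ)) (g := f) (v := v) (by simp) (by simpa using hi)
    (by simpa using hf.continuous.integrable_of_hasCompactSupport hc)
    (fun _ _ => differentiableAt_const _) (fun x _ => hf.differentiable one_ne_zero x)
  simpa using h

variable {u : E → ℂ} {η ζ : E → ℝ}

/-- Green's identity for `η ⟪iu, ∂u⟫`. -/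
theorem integral_mul_inner_I_fderiv_fderiv (hu : ContDiff ℝ 2 u) (hη : ContDiff ℝ 2 η)
    (hc : HasCompactSupport η) (v : E) :
    ∫ x, η x * ⟪Complex.I * u x, fderiv ℝ (fun y => fderiv ℝ u y v) x v⟫ ∂μ =
      -∫ x, fderiv ℝ η x v * ⟪Complex.I * u x, fderiv ℝ u x v⟫ ∂μ := by
  have hu1 : ContDiff ℝ 1 fun y => fderiv ℝ u y v := hu.fderiv_apply_const (by norm_num) v
  have hu2 : ContDiff ℝ 0 fun x => fderiv ℝ (fun y => fderiv ℝ u y v) x v :=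
    hu1.fderiv_apply_const (by norm_num) v
  have hη1 : ContDiff ℝ 1 fun y => fderiv ℝ η y v := hη.fderiv_apply_const (by norm_num) v
  have hul : ContDiff ℝ 1 u := hu.of_le (by norm_num)
  have hηl : ContDiff ℝ 1 η := hη.of_le (by norm_num)
  have hF : ContDiff ℝ 1 fun x => η x * ⟪Complex.I * u x, fderiv ℝ u x v⟫ :=
    hηl.mul ((contDiff_const.mul hul).inner ℝ hu1)
  have hFc : HasCompactSupport fun x => η x * ⟪Complex.I * u x, fderiv ℝ u x v⟫ := hc.mul_right
  -- The third product-rule term, `η ⟪i∂u, ∂u⟫`, vanishes: `iz` is orthogonal to `z` over the reals.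
  have hD : ∀ x, fderiv ℝ (fun x => η x * ⟪Complex.I * u x, fderiv ℝ u x v⟫) x v =
      η x * ⟪Complex.I * u x, fderiv ℝ (fun y => fderiv ℝ u y v) x v⟫ +
        fderiv ℝ η x v * ⟪Complex.I * u x, fderiv ℝ u x v⟫ := by
    intro x
    have h1 := (hul.differentiable one_ne_zero x).hasFDerivAt
    have h2 := (hu1.differentiable one_ne_zero x).hasFDerivAt
    have h3 := (hηl.differentiable one_ne_zero x).hasFDerivAt
    have h4 := (h3.mul ((h1.const_mul Complex.I).inner ℝ h2)).fderiv
    refine (DFunLike.congr_fun h4 v).trans ?_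
    simp [Complex.inner]
    ring
  have h0 := integral_fderiv_apply_eq_zero (μ := μ) hF hFc v
  simp only [hD] at h0
  rw [integral_add] at h0
  · linarith
  · refine Continuous.integrable_of_hasCompactSupport ?_ hc.mul_right
    exact hη.continuous.mul ((continuous_const.mul hu.continuous).inner hu2.continuous)
  · refine Continuous.integrable_of_hasCompactSupport ?_ (hc.fderiv_apply (𝕜 := ℝ) v).mul_right
    exact hη1.continuous.mul ((continuous_const.mul hu.continuous).inner hu1.continuous)

/-- The derivative of `ζ ⟪u, ∂u⟫ - ½ ∂ζ |u|²` integrates to zero, and its terms `∂ζ ⟪u, ∂u⟫` cancel.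
This trades the gradient for `u` and its second derivatives. -/
theorem integral_mul_norm_fderiv_sq (hu : ContDiff ℝ 2 u) (hζ : ContDiff ℝ 2 ζ)
    (hc : HasCompactSupport ζ) (v : E) :
    ∫ x, ζ x * ‖fderiv ℝ u x v‖ ^ 2 ∂μ =
      ∫ x, (1 / 2 * fderiv ℝ (fun y => fderiv ℝ ζ y v) x v * ‖u x‖ ^ 2 -
        ζ x * ⟪u x, fderiv ℝ (fun y => fderiv ℝ u y v) x v⟫) ∂μ := by
  have hu1 : ContDiff ℝ 1 fun y => fderiv ℝ u y v := hu.fderiv_apply_const (by norm_num) v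
  have hu2 : ContDiff ℝ 0 fun x => fderiv ℝ (fun y => fderiv ℝ u y v) x v :=
    hu1.fderiv_apply_const (by norm_num) v
  have hζ1 : ContDiff ℝ 1 fun y => fderiv ℝ ζ y v := hζ.fderiv_apply_const (by norm_num) v
  have hζ2 : ContDiff ℝ 0 fun x => fderiv ℝ (fun y => fderiv ℝ ζ y v) x v :=
    hζ1.fderiv_apply_const (by norm_num) v
  have hul : ContDiff ℝ 1 u := hu.of_le (by norm_num)
  have hζl : ContDiff ℝ 1 ζ := hζ.of_le (by norm_num)
  have hc1 := hc.fderiv_apply (𝕜 := ℝ) v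
  have hc2 := hc1.fderiv_apply (𝕜 := ℝ) v
  have hF : ContDiff ℝ 1 fun x => ζ x * ⟪u x, fderiv ℝ u x v⟫ -
      fderiv ℝ ζ x v * (1 / 2 * ⟪u x, u x⟫) :=
    (hζl.mul (hul.inner ℝ hu1)).sub (hζ1.mul (contDiff_const.mul (hul.inner ℝ hul)))
  have hFc : HasCompactSupport fun x => ζ x * ⟪u x, fderiv ℝ u x v⟫ -
      fderiv ℝ ζ x v * (1 / 2 * ⟪u x, u x⟫) := hc.mul_right.sub hc1.mul_right
  have hD : ∀ x, fderiv ℝ (fun x => ζ x * ⟪u x, fderiv ℝ u x v⟫ -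
      fderiv ℝ ζ x v * (1 / 2 * ⟪u x, u x⟫)) x v = ζ x * ‖fderiv ℝ u x v‖ ^ 2 -
      (1 / 2 * fderiv ℝ (fun y => fderiv ℝ ζ y v) x v * ‖u x‖ ^ 2 -
        ζ x * ⟪u x, fderiv ℝ (fun y => fderiv ℝ u y v) x v⟫) := by
    intro x
    have h1 := (hul.differentiable one_ne_zero x).hasFDerivAt
    have h2 := (hu1.differentiable one_ne_zero x).hasFDerivAt
    have h3 := (hζl.differentiable one_ne_zero x).hasFDerivAt
    have h4 := (hζ1.differentiable one_ne_zero x).hasFDerivAt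
    have h5 := ((h3.mul (h1.inner ℝ h2)).sub (h4.mul ((h1.inner ℝ h1).const_mul (1 / 2)))).fderiv
    refine (DFunLike.congr_fun h5 v).trans ?_
    rw [← real_inner_self_eq_norm_sq, ← real_inner_self_eq_norm_sq]
    simp [Complex.inner]
    ring
  have h0 := integral_fderiv_apply_eq_zero (μ := μ) hF hFc v
  simp only [hD] at h0
  rw [integral_sub] at h0
  · linarith
  · refine Continuous.integrable_of_hasCompactSupport ?_ hc.mul_right
    exact hζ.continuous.mul (hu1.continuous.norm.pow 2)
  · refine Continuous.integrable_of_hasCompactSupport ?_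
      ((hc2.mul_left (f := fun _ => (1 / 2 : ℝ))).mul_right.sub hc.mul_right)
    exact ((continuous_const.mul hζ2.continuous).mul (hu.continuous.norm.pow 2)).sub
      (hζ.continuous.mul (hu.continuous.inner hu2.continuous))

/-- The imaginary part of `∫ η ū Δu` is controlled by `u` and `Δu` on the support of `∇η`. -/
theorem abs_integral_mul_inner_I_sumSecondDeriv_le {ι : Type*} [Fintype ι] (v : ι → E)
    (hu : ContDiff ℝ 2 u) (hu2 : MemLp u 2 μ) (hη : ContDiff ℝ 3 η) (hc : HasCompactSupport η)
    {S : Set E} (hS : MeasurableSet S) (hηS : ∀ x ∉ S, fderiv ℝ η x = 0)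
    (hζ : ∀ x, ζ x = ∑ i, fderiv ℝ η x (v i) ^ 2)
    {M : ℝ} (hM : ∀ x ∈ S, |sumSecondDeriv v ζ x| ≤ M)
    (hM' : ∀ x ∉ S, sumSecondDeriv v ζ x = 0) :
    |∫ x, η x * ⟪Complex.I * u x, sumSecondDeriv v u x⟫ ∂μ| ≤
      (Fintype.card ι / 2 + M / 4 + 1 / 4) * ∫ x in S, ‖u x‖ ^ 2 ∂μ +
        1 / 4 * ∫ x, ζ x ^ 2 * ‖sumSecondDeriv v u x‖ ^ 2 ∂μ := by
  have hu1 : ∀ i, ContDiff ℝ 1 fun y => fderiv ℝ u y (v i) :=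
    fun i => hu.fderiv_apply_const (by norm_num) (v i)
  have hu2' : ∀ i, Continuous fun x => fderiv ℝ (fun y => fderiv ℝ u y (v i)) x (v i) :=
    fun i => ((hu1 i).fderiv_apply_const (m := 0) (by norm_num) (v i)).continuous
  have hη1 : ∀ i, ContDiff ℝ 2 fun y => fderiv ℝ η y (v i) :=
    fun i => hη.fderiv_apply_const (by norm_num) (v i)
  have hηl : ContDiff ℝ 2 η := hη.of_le (by norm_num)
  have hζe : ζ = fun x => ∑ i, fderiv ℝ η x (v i) ^ 2 := funext hζ
  have hζd : ContDiff ℝ 2 ζ := by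
    rw [hζe]
    exact ContDiff.sum fun i _ => (hη1 i).pow 2
  have hζc : HasCompactSupport ζ := by
    have : ζ = (fun L : E →L[ℝ] ℝ => ∑ i, L (v i) ^ 2) ∘ fderiv ℝ η := hζe
    rw [this]
    exact (hc.fderiv (𝕜 := ℝ)).comp_left (by simp)
  have hζ0 : ∀ x, 0 ≤ ζ x := fun x => by rw [hζ]; positivity
  have hζ1 : ∀ i, ContDiff ℝ 1 fun y => fderiv ℝ ζ y (v i) :=
    fun i => hζd.fderiv_apply_const (by norm_num) (v i)
  have hζ2 : ∀ i, Continuous fun x => fderiv ℝ (fun y => fderiv ℝ ζ y (v i)) x (v i) :=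
    fun i => ((hζ1 i).fderiv_apply_const (m := 0) (by norm_num) (v i)).continuous
  have hLu : Continuous (sumSecondDeriv v u) := continuous_finsetSum _ fun i _ => hu2' i
  have hLζ : Continuous (sumSecondDeriv v ζ) := continuous_finsetSum _ fun i _ => hζ2 i
  have hLζc : HasCompactSupport (sumSecondDeriv v ζ) := by
    have : ∀ s : Finset ι, HasCompactSupport fun x =>
        ∑ i ∈ s, fderiv ℝ (fun y => fderiv ℝ ζ y (v i)) x (v i) := by
      intro s
      classical
      induction s using Finset.induction_on with
      | empty => exact HasCompactSupport.zero
      | insert i s hi ih =>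
        simp only [Finset.sum_insert hi]
        exact ((hζc.fderiv_apply (𝕜 := ℝ) (v i)).fderiv_apply (𝕜 := ℝ) (v i)).add ih
    exact this Finset.univ
  have husq : Integrable (fun x => ‖u x‖ ^ 2) μ := hu2.integrable_norm_pow two_ne_zero
  have husqS : Integrable (S.indicator fun x => ‖u x‖ ^ 2) μ := husq.indicator hS
  have hgrad : ∀ i, Integrable (fun x => ζ x * ‖fderiv ℝ u x (v i)‖ ^ 2) μ := fun i =>
    (hζd.continuous.mul ((hu1 i).continuous.norm.pow 2)).integrable_of_hasCompactSupport
      hζc.mul_right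
  have hcross : ∀ i, Integrable
      (fun x => fderiv ℝ η x (v i) * ⟪Complex.I * u x, fderiv ℝ u x (v i)⟫) μ := fun i =>
    ((hη1 i).continuous.mul ((continuous_const.mul hu.continuous).inner
      (hu1 i).continuous)).integrable_of_hasCompactSupport
        (hc.fderiv_apply (𝕜 := ℝ) (v i)).mul_right
  have hmain : Integrable (fun x => ζ x ^ 2 * ‖sumSecondDeriv v u x‖ ^ 2) μ :=
    ((hζd.continuous.pow 2).mul (hLu.norm.pow 2)).integrable_of_hasCompactSupport
      (by simpa only [pow_two, mul_assoc] using hζc.mul_right)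
  have hstep1 : ∫ x, η x * ⟪Complex.I * u x, sumSecondDeriv v u x⟫ ∂μ =
      -∑ i, ∫ x, fderiv ℝ η x (v i) * ⟪Complex.I * u x, fderiv ℝ u x (v i)⟫ ∂μ := by
    simp only [sumSecondDeriv, inner_sum, Finset.mul_sum]
    rw [integral_finsetSum, ← Finset.sum_neg_distrib]
    · exact Finset.sum_congr rfl fun i _ => integral_mul_inner_I_fderiv_fderiv hu hηl hc (v i)
    · intro i _
      exact (hη.continuous.mul ((continuous_const.mul hu.continuous).inner
        (hu2' i))).integrable_of_hasCompactSupport hc.mul_right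
  -- Pointwise `ab ≤ (a² + b²) / 2` with `a = |u|`, `b = |∂ᵢη| |∂ᵢu|`, together with `(∂ᵢη)² ≤ ζ`.
  have hstep2 : ∀ i, |∫ x, fderiv ℝ η x (v i) * ⟪Complex.I * u x, fderiv ℝ u x (v i)⟫ ∂μ| ≤
      1 / 2 * ∫ x in S, ‖u x‖ ^ 2 ∂μ + 1 / 2 * ∫ x, ζ x * ‖fderiv ℝ u x (v i)‖ ^ 2 ∂μ := by
    intro i
    rw [← integral_indicator hS, ← integral_const_mul, ← integral_const_mul,
      ← integral_add (husqS.const_mul _) ((hgrad i).const_mul _)]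
    refine (abs_integral_le_integral_abs).trans
      (integral_mono (hcross i).abs ((husqS.const_mul _).add ((hgrad i).const_mul _)) fun x => ?_)
    by_cases hx : x ∈ S
    · simp only [Set.indicator_of_mem hx]
      have h1 : |⟪Complex.I * u x, fderiv ℝ u x (v i)⟫| ≤ ‖u x‖ * ‖fderiv ℝ u x (v i)‖ := by
        simpa using abs_real_inner_le_norm (Complex.I * u x) (fderiv ℝ u x (v i))
      have h2 : fderiv ℝ η x (v i) ^ 2 ≤ ζ x := by
        rw [hζ]
        exact Finset.single_le_sum (f := fun i => fderiv ℝ η x (v i) ^ 2)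
          (fun j _ => sq_nonneg _) (Finset.mem_univ i)
      rw [abs_mul]
      have h3 : |fderiv ℝ η x (v i)| * |⟪Complex.I * u x, fderiv ℝ u x (v i)⟫| ≤
          |fderiv ℝ η x (v i)| * (‖u x‖ * ‖fderiv ℝ u x (v i)‖) := by gcongr
      have h4 : fderiv ℝ η x (v i) ^ 2 * ‖fderiv ℝ u x (v i)‖ ^ 2 ≤
          ζ x * ‖fderiv ℝ u x (v i)‖ ^ 2 := by gcongr
      have h5 := sq_nonneg (‖u x‖ - |fderiv ℝ η x (v i)| * ‖fderiv ℝ u x (v i)‖)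
      have h6 := sq_abs (fderiv ℝ η x (v i))
      rw [← h6] at h4
      nlinarith
    · simp [Set.indicator_of_notMem hx, hηS x hx, hζ x]
  have hstep3 : ∑ i, ∫ x, ζ x * ‖fderiv ℝ u x (v i)‖ ^ 2 ∂μ =
      ∫ x, (1 / 2 * sumSecondDeriv v ζ x * ‖u x‖ ^ 2 -
        ζ x * ⟪u x, sumSecondDeriv v u x⟫) ∂μ := by
    simp only [integral_mul_norm_fderiv_sq hu hζd hζc]
    rw [← integral_finsetSum]
    · congr 1
      funext x
      simp only [sumSecondDeriv, inner_sum, Finset.mul_sum, Finset.sum_mul,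
        Finset.sum_sub_distrib]
    · intro i _
      refine Continuous.integrable_of_hasCompactSupport ?_
        ((((hζc.fderiv_apply (𝕜 := ℝ) (v i)).fderiv_apply (𝕜 := ℝ) (v i)).mul_left
          (f := fun _ => (1 / 2 : ℝ))).mul_right.sub hζc.mul_right)
      exact ((continuous_const.mul (hζ2 i)).mul (hu.continuous.norm.pow 2)).sub
        (hζd.continuous.mul (hu.continuous.inner (hu2' i)))
  -- Splitting `|u| · ζ|Δu|` so that all of `ζ` stays with `Δu` produces `ζ²`, the weight that later
  -- beats a quadratically growing potential.
  have hstep4 : ∫ x, (1 / 2 * sumSecondDeriv v ζ x * ‖u x‖ ^ 2 -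
        ζ x * ⟪u x, sumSecondDeriv v u x⟫) ∂μ ≤
      (M / 2 + 1 / 2) * ∫ x in S, ‖u x‖ ^ 2 ∂μ +
        1 / 2 * ∫ x, ζ x ^ 2 * ‖sumSecondDeriv v u x‖ ^ 2 ∂μ := by
    rw [← integral_indicator hS, ← integral_const_mul, ← integral_const_mul,
      ← integral_add (husqS.const_mul _) (hmain.const_mul _)]
    refine integral_mono ?_ ((husqS.const_mul _).add (hmain.const_mul _)) fun x => ?_
    · refine Continuous.integrable_of_hasCompactSupport ?_
        ((hLζc.mul_left (f := fun _ => (1 / 2 : ℝ))).mul_right.sub hζc.mul_right)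
      exact ((continuous_const.mul hLζ).mul (hu.continuous.norm.pow 2)).sub
        (hζd.continuous.mul (hu.continuous.inner hLu))
    · by_cases hx : x ∈ S
      · simp only [Set.indicator_of_mem hx]
        have h1 := (abs_le.1 (abs_real_inner_le_norm (u x) (sumSecondDeriv v u x))).1
        have h2 : sumSecondDeriv v ζ x * ‖u x‖ ^ 2 ≤ M * ‖u x‖ ^ 2 := by
          gcongr
          exact (le_abs_self _).trans (hM x hx)
        have h3 := mul_le_mul_of_nonneg_left h1 (hζ0 x)
        have h4 := sq_nonneg (‖u x‖ - ζ x * ‖sumSecondDeriv v u x‖)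
        nlinarith
      · have hz : ζ x = 0 := by simp [hζ, hηS x hx]
        simp [Set.indicator_of_notMem hx, hM' x hx, hz]
  rw [hstep1, abs_neg]
  calc _ ≤ ∑ i, |∫ x, fderiv ℝ η x (v i) * ⟪Complex.I * u x, fderiv ℝ u x (v i)⟫ ∂μ| :=
        Finset.abs_sum_le_sum_abs _ _
    _ ≤ ∑ i, (1 / 2 * ∫ x in S, ‖u x‖ ^ 2 ∂μ +
        1 / 2 * ∫ x, ζ x * ‖fderiv ℝ u x (v i)‖ ^ 2 ∂μ) := Finset.sum_le_sum fun i _ => hstep2 i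
    _ = Fintype.card ι / 2 * ∫ x in S, ‖u x‖ ^ 2 ∂μ +
        1 / 2 * ∑ i, ∫ x, ζ x * ‖fderiv ℝ u x (v i)‖ ^ 2 ∂μ := by
      rw [Finset.sum_add_distrib, Finset.mul_sum]
      simp
      ring
    _ ≤ _ := by
      rw [hstep3]
      linarith

end Caccioppoli

end

/-! ### Cutoff functions at scale `R`. -/

section

open scoped Topology

section Cutoff

variable {E ι F : Type*} [NormedAddCommGroup E] [NormedSpace ℝ E] [Fintype ι]
  [NormedAddCommGroup F] [NormedSpace ℝ F]

theorem sumSecondDeriv_eq_zero_of_eventuallyEq (v : ι → E) {f : E → F} {x : E}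
    (hf : f =ᶠ[𝓝 x] 0) : sumSecondDeriv v f x = 0 := by
  refine Finset.sum_eq_zero fun i _ => ?_
  have h1 : (fun y => fderiv ℝ f y (v i)) =ᶠ[𝓝 x] fun _ => 0 := by
    filter_upwards [hf.eventuallyEq_nhds] with y hy
    rw [hy.fderiv_eq]
    simp
  rw [h1.fderiv_eq]
  simp

theorem sumSecondDeriv_const_mul_comp_smul (v : ι → E) {f : E → ℝ} (hf : ContDiff ℝ 2 f)
    (a c : ℝ) (x : E) :
    sumSecondDeriv v (fun y => a * f (c • y)) x = a * c ^ 2 * sumSecondDeriv v f (c • x) := by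
  unfold sumSecondDeriv
  rw [Finset.mul_sum]
  refine Finset.sum_congr rfl fun i _ => ?_
  have hd : Differentiable ℝ f := hf.differentiable two_ne_zero
  have hd1 : Differentiable ℝ fun y => fderiv ℝ f y (v i) :=
    (hf.fderiv_apply_const (m := 1) (by norm_num) (v i)).differentiable one_ne_zero
  have h1 : (fun y => fderiv ℝ (fun y => a * f (c • y)) y (v i)) =
      fun y => (a * c) * (fun z => fderiv ℝ f z (v i)) (c • y) := by
    funext y
    rw [fderiv_const_mul (by fun_prop), fderiv_comp_smul]
    simp [mul_assoc]
  rw [h1, fderiv_const_mul (by fun_prop),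
    fderiv_comp_smul (f := fun z => fderiv ℝ f z (v i))]
  simp
  ring

theorem ContDiff.continuous_sumSecondDeriv (v : ι → E) {f : E → F} (hf : ContDiff ℝ 2 f) :
    Continuous (sumSecondDeriv v f) :=
  continuous_finsetSum _ fun i _ =>
    ((hf.fderiv_apply_const (m := 1) (by norm_num) (v i)).fderiv_apply_const
      (m := 0) (by norm_num) (v i)).continuous

theorem HasCompactSupport.sumSecondDeriv (v : ι → E) {f : E → F} (hf : HasCompactSupport f) :
    HasCompactSupport (sumSecondDeriv v f) := by
  refine HasCompactSupport.intro hf fun x hx => sumSecondDeriv_eq_zero_of_eventuallyEq v ?_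
  exact notMem_tsupport_iff_eventuallyEq.1 hx

/-- Smooth cutoff functions at scale `R`, with `∑ᵢ (∂ᵢη)² = O(R⁻²)`. -/
theorem exists_cutoff [FiniteDimensional ℝ E] (v : ι → E) :
    ∃ C ≥ (0 : ℝ), ∀ R ≥ (1 : ℝ), ∃ η ζ : E → ℝ, ContDiff ℝ 3 η ∧ HasCompactSupport η ∧
      (∀ x, 0 ≤ η x) ∧ (∀ x, η x ≤ 1) ∧ (∀ x, ‖x‖ ≤ R → η x = 1) ∧
      (∀ x, 2 * R ≤ ‖x‖ → η x = 0) ∧ (∀ x, ‖x‖ < R → fderiv ℝ η x = 0) ∧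
      Continuous ζ ∧
      (∀ x, ζ x = ∑ i, fderiv ℝ η x (v i) ^ 2) ∧ (∀ x, ζ x ≤ C / R ^ 2) ∧
      (∀ x, 2 * R < ‖x‖ → ζ x = 0) ∧
      (∀ x, |sumSecondDeriv v ζ x| ≤ C) ∧ ∀ x, ‖x‖ < R → sumSecondDeriv v ζ x = 0 := by
  -- One fixed bump is dilated: `η x = χ (x / R)` and `ζ x = R⁻² Z (x / R)`, so bounds on `Z` and
  -- its second derivatives serve every `R`.
  let χ : ContDiffBump (0 : E) := ⟨1, 2, one_pos, one_lt_two⟩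
  have hχ : ContDiff ℝ 3 χ := χ.contDiff
  let Z : E → ℝ := fun x => ∑ i, fderiv ℝ χ x (v i) ^ 2
  have hZ : ContDiff ℝ 2 Z :=
    ContDiff.sum fun i _ => (hχ.fderiv_apply_const (by norm_num) (v i)).pow 2
  have hZc : HasCompactSupport Z :=
    (χ.hasCompactSupport.fderiv (𝕜 := ℝ)).comp_left
      (g := fun L : E →L[ℝ] ℝ => ∑ i, L (v i) ^ 2) (by simp)
  obtain ⟨C₁, hC₁⟩ := hZc.exists_bound_of_continuous hZ.continuous
  obtain ⟨C₂, hC₂⟩ := (hZc.sumSecondDeriv v).exists_bound_of_continuous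
    (hZ.continuous_sumSecondDeriv v)
  have hC : 0 ≤ max C₁ C₂ := ((norm_nonneg _).trans (hC₁ 0)).trans (le_max_left _ _)
  refine ⟨max C₁ C₂, hC, fun R hR => ?_⟩
  have hR0 : 0 < R := by linarith
  have hnorm : ∀ x : E, ‖R⁻¹ • x‖ = ‖x‖ / R := fun x => by
    rw [norm_smul, norm_inv, Real.norm_of_nonneg hR0.le, inv_mul_eq_div]
  have hone : ∀ x : E, ‖x‖ ≤ R → χ (R⁻¹ • x) = 1 := by
    intro x hx
    apply χ.one_of_mem_closedBall
    rw [mem_closedBall_zero_iff, hnorm]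
    exact div_le_one_of_le₀ hx hR0.le
  have hzero : ∀ x : E, 2 * R ≤ ‖x‖ → χ (R⁻¹ • x) = 0 := by
    intro x hx
    apply χ.zero_of_le_dist
    rw [dist_zero_right, hnorm, le_div_iff₀ hR0]
    exact hx
  have hfd : ∀ x i, fderiv ℝ (fun y => χ (R⁻¹ • y)) x (v i) =
      R⁻¹ * fderiv ℝ χ (R⁻¹ • x) (v i) := by
    intro x i
    rw [fderiv_comp_smul]
    simp
  have hfd1 : ∀ x : E, ‖x‖ < R → fderiv ℝ (fun y => χ (R⁻¹ • y)) x = 0 := by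
    intro x hx
    have : (fun y => χ (R⁻¹ • y)) =ᶠ[𝓝 x] fun _ => 1 := by
      filter_upwards [(isOpen_lt continuous_norm continuous_const).mem_nhds hx] with y hy
      exact hone y (le_of_lt hy)
    rw [this.fderiv_eq]
    simp
  have hfd2 : ∀ x : E, 2 * R < ‖x‖ → fderiv ℝ (fun y => χ (R⁻¹ • y)) x = 0 := by
    intro x hx
    have : (fun y => χ (R⁻¹ • y)) =ᶠ[𝓝 x] fun _ => 0 := by
      filter_upwards [(isOpen_lt continuous_const continuous_norm).mem_nhds hx] with y hy
      exact hzero y (le_of_lt hy)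
    rw [this.fderiv_eq]
    simp
  have hζ : ∀ x, (R⁻¹) ^ 2 * Z (R⁻¹ • x) =
      ∑ i, fderiv ℝ (fun y => χ (R⁻¹ • y)) x (v i) ^ 2 := by
    intro x
    simp only [hfd, Z, mul_pow, Finset.mul_sum]
  refine ⟨fun x => χ (R⁻¹ • x), fun x => (R⁻¹) ^ 2 * Z (R⁻¹ • x),
    hχ.comp (contDiff_const_smul _), ?_, fun x => χ.nonneg, fun x => χ.le_one, hone, hzero, hfd1,
    continuous_const.mul (hZ.continuous.comp (continuous_const_smul _)), hζ, ?_, ?_, ?_, ?_⟩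
  · exact HasCompactSupport.intro (isCompact_closedBall (0 : E) (2 * R)) fun x hx =>
      hzero x (by simpa using le_of_lt (by simpa using hx))
  · intro x
    have h1 : Z (R⁻¹ • x) ≤ max C₁ C₂ :=
      (le_abs_self _).trans ((hC₁ _).trans (le_max_left _ _))
    beta_reduce
    rw [inv_pow, inv_mul_eq_div]
    gcongr
  · intro x hx
    simp only [hζ, hfd2 x hx]
    simp
  · intro x
    -- The dilation contributes `R⁻² · R⁻²`, which is at most 1 since `R ≥ 1`; no decay is needed
    -- here.
    rw [sumSecondDeriv_const_mul_comp_smul v hZ, abs_mul]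
    have h1 : |sumSecondDeriv v Z (R⁻¹ • x)| ≤ max C₁ C₂ := (hC₂ _).trans (le_max_right _ _)
    have h2 : |(R⁻¹) ^ 2 * (R⁻¹) ^ 2| ≤ 1 := by
      have : R⁻¹ ≤ 1 := inv_le_one_of_one_le₀ hR
      rw [abs_of_nonneg (by positivity), ← pow_add]
      exact pow_le_one₀ (by positivity) this
    calc _ ≤ 1 * max C₁ C₂ := mul_le_mul h2 h1 (abs_nonneg _) zero_le_one
      _ = _ := one_mul _
  · intro x hx
    apply sumSecondDeriv_eq_zero_of_eventuallyEq
    filter_upwards [(isOpen_lt continuous_norm continuous_const).mem_nhds hx] with y hy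
    rw [hζ, hfd1 y hy]
    simp

end Cutoff

end

/-! ### Mollification in `L²`. -/

section

open scoped Topology ENNReal Convolution

section Mollification

/-- The convolution of a complex valued function with a real valued kernel. -/
noncomputable abbrev kernelConvolution {E : Type*} [NormedAddCommGroup E] [MeasurableSpace E]
    (μ : Measure E) (f : E → ℂ) (g : E → ℝ) : E → ℂ :=
  convolution f g (ContinuousLinearMap.flip (ContinuousLinearMap.lsmul ℝ ℝ)) μ

theorem kernelConvolution_apply {E : Type*} [NormedAddCommGroup E] [MeasurableSpace E]
    (μ : Measure E) (f : E → ℂ) (g : E → ℝ) (x : E) :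
    kernelConvolution μ f g x = ∫ t, g (x - t) • f t ∂μ := rfl

/-- The square of a weighted average is at most the weighted average of the squares. -/
theorem lintegral_mul_sq_le {X : Type*} [MeasurableSpace X] {μ : Measure X} {G F : X → ℝ≥0∞}
    (hG : Measurable G) (hF : Measurable F) (h1 : ∫⁻ x, G x ∂μ = 1) :
    (∫⁻ x, G x * F x ∂μ) ^ 2 ≤ ∫⁻ x, G x * F x ^ 2 ∂μ := by
  -- Cauchy–Schwarz of `F` against 1 in the probability measure with density `G`.
  have h := ENNReal.lintegral_mul_le_Lp_mul_Lq (μ.withDensity G) Real.HolderConjugate.two_two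
    (f := fun _ => 1) (g := F) aemeasurable_const hF.aemeasurable
  rw [lintegral_withDensity_eq_lintegral_mul _ hG (by fun_prop),
    lintegral_withDensity_eq_lintegral_mul _ hG (by fun_prop),
    lintegral_withDensity_eq_lintegral_mul _ hG (by fun_prop)] at h
  simp only [Pi.mul_apply, one_mul, ENNReal.rpow_two, one_pow, mul_one, h1,
    ENNReal.one_rpow] at h
  calc _ ≤ ((∫⁻ x, G x * F x ^ 2 ∂μ) ^ (1 / 2 : ℝ)) ^ 2 := by gcongr
    _ = _ := by
      rw [← ENNReal.rpow_two, ← ENNReal.rpow_mul]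
      norm_num

theorem eLpNorm_two_sq {X F : Type*} [MeasurableSpace X] {μ : Measure X} [NormedAddCommGroup F]
    (f : X → F) : eLpNorm f 2 μ ^ 2 = ∫⁻ x, ‖f x‖ₑ ^ 2 ∂μ := by
  have h := eLpNorm_nnreal_pow_eq_lintegral (μ := μ) (f := f) (p := 2) two_ne_zero
  simpa using h

variable {E : Type*} [NormedAddCommGroup E] [NormedSpace ℝ E] [FiniteDimensional ℝ E]
  [MeasurableSpace E] [BorelSpace E] {μ : Measure E} [μ.IsAddHaarMeasure]

/-- Translations are continuous in `L²`. -/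
theorem tendsto_eLpNorm_comp_sub_sub {f : E → ℂ} (hf : MemLp f 2 μ) :
    Tendsto (fun t => eLpNorm (fun x => f (x - t) - f x) 2 μ) (𝓝 0) (𝓝 0) := by
  -- Currying makes the translations a continuous family in `C(E, E)`, as continuity of composition
  -- on `Lp` requires.
  let g : C(E, C(E, E)) := ContinuousMap.curry ⟨fun p : E × E => p.2 - p.1, by fun_prop⟩
  have hg : ∀ t, MeasurePreserving (g t) μ μ := fun t => measurePreserving_sub_right μ t
  have h1 := (tendsto_const_nhds (x := hf.toLp f) (f := 𝓝 (0 : E))).compMeasurePreservingLp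
    (g.continuous.tendsto 0) hg (hg 0) (by norm_num)
  rw [tendsto_iff_edist_tendsto_0] at h1
  refine h1.congr fun t => ?_
  rw [Lp.edist_def]
  apply eLpNorm_congr_ae
  have h2 : ∀ t, Lp.compMeasurePreserving (g t) (hg t) (hf.toLp f) =ᵐ[μ] fun x => f (x - t) :=
    fun t => (Lp.coeFn_compMeasurePreserving _ _).trans
      ((hg t).quasiMeasurePreserving.ae_eq_comp hf.coeFn_toLp)
  filter_upwards [h2 t, h2 0] with x hx hx0
  rw [Pi.sub_apply, hx, hx0, sub_zero]

/-- The difference is the average of `f (x - t) - f x` over the probability density `g`. Squaring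
inside the average and applying Tonelli reduces the bound to translations by `t` with `g t ≠ 0`. -/
theorem lintegral_enorm_convolution_sub_sq_le {f : E → ℂ} (hfm : StronglyMeasurable f)
    (hf : LocallyIntegrable f μ) {g : E → ℝ} (hg : Continuous g) (hgc : HasCompactSupport g)
    (hg0 : ∀ x, 0 ≤ g x) (hg1 : ∫ x, g x ∂μ = 1) {ε : ℝ≥0∞}
    (hε : ∀ t, g t ≠ 0 → ∫⁻ x, ‖f (x - t) - f x‖ₑ ^ 2 ∂μ ≤ ε) :
    ∫⁻ x, ‖kernelConvolution μ f g x - f x‖ₑ ^ 2 ∂μ ≤ ε := by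
  have hgi : Integrable g μ := hg.integrable_of_hasCompactSupport hgc
  have hG1 : ∫⁻ t, ‖g t‖ₑ ∂μ = 1 := by
    rw [← ofReal_integral_norm_eq_lintegral_enorm hgi]
    simp [abs_of_nonneg (hg0 _), hg1]
  have hfm' : Measurable f := hfm.measurable
  have hpt : ∀ x, ‖kernelConvolution μ f g x - f x‖ₑ ^ 2 ≤
      ∫⁻ t, ‖g t‖ₑ * ‖f (x - t) - f x‖ₑ ^ 2 ∂μ := by
    intro x
    have hint : Integrable (fun t => g (x - t) • f t) μ :=
      (hgc.convolutionExists_right (ContinuousLinearMap.flip (ContinuousLinearMap.lsmul ℝ ℝ))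
        hf hg x)
    have hint2 : Integrable (fun t => g t • f (x - t)) μ := by
      simpa using hint.comp_sub_left x
    have h1 : kernelConvolution μ f g x - f x = ∫ t, g t • (f (x - t) - f x) ∂μ := by
      simp only [smul_sub]
      rw [integral_sub hint2 (hgi.smul_const _), integral_smul_const, hg1, one_smul,
        kernelConvolution_apply, ← integral_sub_left_eq_self _ μ x]
      simp
    rw [h1]
    refine le_trans (pow_le_pow_left' (enorm_integral_le_lintegral_enorm _) 2) ?_
    simp only [enorm_smul]
    exact lintegral_mul_sq_le (by fun_prop) (by fun_prop) hG1
  calc _ ≤ ∫⁻ x, ∫⁻ t, ‖g t‖ₑ * ‖f (x - t) - f x‖ₑ ^ 2 ∂μ ∂μ := lintegral_mono hpt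
    _ = ∫⁻ t, ∫⁻ x, ‖g t‖ₑ * ‖f (x - t) - f x‖ₑ ^ 2 ∂μ ∂μ :=
      lintegral_lintegral_swap (by
        have : Measurable (Function.uncurry fun x t => ‖g t‖ₑ * ‖f (x - t) - f x‖ₑ ^ 2) := by
          have hgm : Measurable g := hg.measurable
          unfold Function.uncurry
          fun_prop
        exact this.aemeasurable)
    _ ≤ ∫⁻ t, ‖g t‖ₑ * ε ∂μ := by
      refine lintegral_mono fun t => ?_
      rw [lintegral_const_mul _ (by fun_prop)]
      by_cases ht : g t = 0
      · simp [ht]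
      · exact mul_le_mul_right (hε t ht) _
    _ = ε := by rw [lintegral_mul_const _ (by fun_prop), hG1, one_mul]

/-- Mollifications of `f ∈ L²` converge to `f` in `L²`. -/
theorem ContDiffBump.tendsto_eLpNorm_convolution_sub {f : E → ℂ} (hfm : StronglyMeasurable f)
    (hf : MemLp f 2 μ) {ι : Type*} {l : Filter ι} {φ : ι → ContDiffBump (0 : E)}
    (hφ : Tendsto (fun i => (φ i).rOut) l (𝓝 0)) :
    Tendsto (fun i => eLpNorm (kernelConvolution μ f ((φ i).normed μ) - f) 2 μ) l (𝓝 0) := by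
  rw [ENNReal.tendsto_nhds_zero]
  intro ε hε
  have h1 := (ENNReal.tendsto_nhds_zero.1 (tendsto_eLpNorm_comp_sub_sub hf)) ε hε
  obtain ⟨r, hr, hball⟩ := Metric.eventually_nhds_iff_ball.1 h1
  filter_upwards [hφ.eventually (gt_mem_nhds hr)] with i hi
  have h2 : ∫⁻ x, ‖kernelConvolution μ f ((φ i).normed μ) x - f x‖ₑ ^ 2 ∂μ ≤ ε ^ 2 := by
    refine lintegral_enorm_convolution_sub_sq_le hfm (hf.locallyIntegrable (by norm_num))
      (φ i).continuous_normed (φ i).hasCompactSupport_normed (φ i).nonneg_normed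
      (φ i).integral_normed fun t ht => ?_
    rw [← eLpNorm_two_sq]
    refine pow_le_pow_left' (hball t ?_) 2
    have : t ∈ Function.support ((φ i).normed μ) := ht
    rw [(φ i).support_normed_eq] at this
    exact Metric.ball_subset_ball hi.le this
  have h3 : eLpNorm (kernelConvolution μ f ((φ i).normed μ) - f) 2 μ ^ 2 ≤ ε ^ 2 := by
    rw [eLpNorm_two_sq]
    exact h2
  exact (ENNReal.pow_le_pow_left_iff two_ne_zero).1 h3

theorem fderiv_convolution_apply {f : E → ℂ} (hf : LocallyIntegrable f μ) {g : E → ℝ}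
    (hg : ContDiff ℝ 1 g) (hgc : HasCompactSupport g) (v : E) :
    (fun x => fderiv ℝ (kernelConvolution μ f g) x v) =
      kernelConvolution μ f fun x => fderiv ℝ g x v := by
  funext x
  rw [(hgc.hasFDerivAt_convolution_right _ hf hg x).fderiv,
    convolution_precompR_apply _ hf (hgc.fderiv (𝕜 := ℝ)) (hg.continuous_fderiv one_ne_zero)]

/-- Both derivatives fall on the kernel, so no regularity of `f` beyond local integrability is
involved. -/
theorem sumSecondDeriv_convolution {ι : Type*} [Fintype ι] (v : ι → E) {f : E → ℂ}
    (hf : LocallyIntegrable f μ) {g : E → ℝ} (hg : ContDiff ℝ 2 g) (hgc : HasCompactSupport g) :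
    sumSecondDeriv v (kernelConvolution μ f g) = kernelConvolution μ f (sumSecondDeriv v g) := by
  have hg1 : ∀ i, ContDiff ℝ 1 fun y => fderiv ℝ g y (v i) :=
    fun i => hg.fderiv_apply_const (by norm_num) (v i)
  funext x
  have h1 : ∀ i, fderiv ℝ (fun y => fderiv ℝ (kernelConvolution μ f g) y (v i)) x (v i) =
      (kernelConvolution μ f fun y => fderiv ℝ (fun z => fderiv ℝ g z (v i)) y (v i)) x := by
    intro i
    rw [fderiv_convolution_apply hf (hg.of_le (by norm_num)) hgc]
    exact congrFun (fderiv_convolution_apply hf (hg1 i) (hgc.fderiv_apply (𝕜 := ℝ) (v i)) (v i)) x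
  simp only [sumSecondDeriv, h1, kernelConvolution_apply, Finset.sum_smul]
  rw [integral_finsetSum]
  intro i _
  exact ((hgc.fderiv_apply (𝕜 := ℝ) (v i)).fderiv_apply (𝕜 := ℝ) (v i)).convolutionExists_right
    (ContinuousLinearMap.flip (ContinuousLinearMap.lsmul ℝ ℝ)) hf
    ((hg1 i).fderiv_apply_const (m := 0) (by norm_num) (v i)).continuous x

end Mollification

end

/-! ### Limits of `L²` pairings. -/

section

open scoped Topology ENNReal RealInnerProductSpace

section L2Limits

variable {X : Type*} [MeasurableSpace X] {μ : Measure X}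

theorem MeasureTheory.MemLp.bounded_mul {m f : X → ℂ} {C : ℝ} (hm : Measurable m)
    (hC : ∀ x, ‖m x‖ ≤ C) (hf : MemLp f 2 μ) : MemLp (fun x => m x * f x) 2 μ :=
  hf.of_le_mul (c := C) (hm.aestronglyMeasurable.mul hf.1) (Eventually.of_forall fun x => by
    rw [norm_mul]
    exact mul_le_mul_of_nonneg_right (hC x) (norm_nonneg _))

theorem tendsto_integral_inner_of_tendsto_eLpNorm {f g : ℕ → X → ℂ} {f₀ g₀ : X → ℂ}
    (hf : ∀ n, MemLp (f n) 2 μ) (hg : ∀ n, MemLp (g n) 2 μ) (hf₀ : MemLp f₀ 2 μ)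
    (hg₀ : MemLp g₀ 2 μ) (hfl : Tendsto (fun n => eLpNorm (f n - f₀) 2 μ) atTop (𝓝 0))
    (hgl : Tendsto (fun n => eLpNorm (g n - g₀) 2 μ) atTop (𝓝 0)) :
    Tendsto (fun n => ∫ x, ⟪f n x, g n x⟫ ∂μ) atTop (𝓝 (∫ x, ⟪f₀ x, g₀ x⟫ ∂μ)) := by
  have h1 := (Lp.tendsto_Lp_iff_tendsto_eLpNorm'' f hf f₀ hf₀).2 hfl
  have h2 := (Lp.tendsto_Lp_iff_tendsto_eLpNorm'' g hg g₀ hg₀).2 hgl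
  have key : ∀ {a b : X → ℂ} (ha : MemLp a 2 μ) (hb : MemLp b 2 μ),
      ⟪ha.toLp a, hb.toLp b⟫ = ∫ x, ⟪a x, b x⟫ ∂μ := by
    intro a b ha hb
    rw [L2.inner_def]
    apply integral_congr_ae
    filter_upwards [ha.coeFn_toLp, hb.coeFn_toLp] with x hx hy
    rw [hx, hy]
  simpa only [key] using h1.inner (𝕜 := ℝ) h2

/-- Every term of the Caccioppoli inequality is such a pairing, with `m` equal to `iη`, the
indicator of `S`, or `ζ²`. -/
theorem tendsto_integral_inner_bounded_mul {m : X → ℂ} {C : ℝ} (hm : Measurable m)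
    (hC : ∀ x, ‖m x‖ ≤ C) {f g : ℕ → X → ℂ} {f₀ g₀ : X → ℂ}
    (hf : ∀ n, MemLp (f n) 2 μ) (hg : ∀ n, MemLp (g n) 2 μ) (hf₀ : MemLp f₀ 2 μ)
    (hg₀ : MemLp g₀ 2 μ) (hfl : Tendsto (fun n => eLpNorm (f n - f₀) 2 μ) atTop (𝓝 0))
    (hgl : Tendsto (fun n => eLpNorm (g n - g₀) 2 μ) atTop (𝓝 0)) :
    Tendsto (fun n => ∫ x, ⟪m x * f n x, g n x⟫ ∂μ) atTop
      (𝓝 (∫ x, ⟪m x * f₀ x, g₀ x⟫ ∂μ)) := by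
  refine tendsto_integral_inner_of_tendsto_eLpNorm (fun n => (hf n).bounded_mul hm hC) hg
    (hf₀.bounded_mul hm hC) hg₀ ?_ hgl
  have h1 : Tendsto (fun n => ENNReal.ofReal C * eLpNorm (f n - f₀) 2 μ) atTop (𝓝 0) := by
    simpa using ENNReal.Tendsto.const_mul hfl (Or.inr ENNReal.ofReal_ne_top)
  refine tendsto_of_tendsto_of_tendsto_of_le_of_le tendsto_const_nhds h1 (fun _ => zero_le) ?_
  intro n
  refine eLpNorm_le_mul_eLpNorm_of_ae_le_mul (Eventually.of_forall fun x => ?_) 2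
  simp only [Pi.sub_apply, ← mul_sub, norm_mul]
  exact mul_le_mul_of_nonneg_right (hC x) (norm_nonneg _)

/-- Puts late mollifications in `L²` from their convergence alone, avoiding Young's inequality. -/
theorem memLp_of_eLpNorm_sub_lt_top {f : X → ℂ} {f₀ : X → ℂ} (hf : AEStronglyMeasurable f μ)
    (hf₀ : MemLp f₀ 2 μ) (h : eLpNorm (f - f₀) 2 μ < ∞) : MemLp f 2 μ := by
  have h1 : MemLp (f - f₀) 2 μ := ⟨hf.sub hf₀.1, h⟩
  simpa using h1.add hf₀

end L2Limits

/-! ### Weak equations and their Caccioppoli inequality. -/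

section WeakLaplacian

variable {E : Type*} [NormedAddCommGroup E] [NormedSpace ℝ E]

theorem fderiv_comp_const_sub_apply (f : E → ℝ) (x t v : E) :
    fderiv ℝ (fun y => f (x - y)) t v = -fderiv ℝ f (x - t) v := by
  have h1 : (fun y => f (x - y)) = fun y => (fun z => f (x + z)) ((-1 : ℝ) • y) := by
    funext y
    simp [sub_eq_add_neg]
  rw [h1, fderiv_comp_smul (f := fun z => f (x + z)), fderiv_comp_add_left]
  simp [sub_eq_add_neg]

theorem sumSecondDeriv_comp_const_sub {ι : Type*} [Fintype ι] (v : ι → E) (f : E → ℝ) (x t : E) :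
    sumSecondDeriv v (fun y => f (x - y)) t = sumSecondDeriv v f (x - t) := by
  unfold sumSecondDeriv
  refine Finset.sum_congr rfl fun i _ => ?_
  simp only [fderiv_comp_const_sub_apply]
  rw [fderiv_fun_neg, neg_apply,
    fderiv_comp_const_sub_apply (f := fun z => fderiv ℝ f z (v i)), neg_neg]

variable [FiniteDimensional ℝ E] [MeasurableSpace E] [BorelSpace E] {μ : Measure E}
  [μ.IsAddHaarMeasure]

/-- `g = -∑ᵢ ∂ᵢ∂ᵢ ψ` in the sense of distributions. -/
def IsWeakNegSumSecondDeriv {ι : Type*} [Fintype ι] (μ : Measure E) (v : ι → E)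
    (ψ g : E → ℂ) : Prop :=
  ∀ f : E → ℝ, ContDiff ℝ (⊤ : ℕ∞) f → HasCompactSupport f →
    ∫ x, sumSecondDeriv v f x • ψ x ∂μ = -∫ x, f x • g x ∂μ

/-- Test the weak equation with `t ↦ ρ (x - t)`; the reflection leaves second derivatives unchanged.
-/
theorem IsWeakNegSumSecondDeriv.sumSecondDeriv_kernelConvolution {ι : Type*} [Fintype ι]
    {v : ι → E} {ψ g : E → ℂ} (h : IsWeakNegSumSecondDeriv μ v ψ g)
    (hψ : LocallyIntegrable ψ μ) {ρ : E → ℝ} (hρ : ContDiff ℝ (⊤ : ℕ∞) ρ)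
    (hc : HasCompactSupport ρ) (x : E) :
    sumSecondDeriv v (kernelConvolution μ ψ ρ) x = -kernelConvolution μ g ρ x := by
  rw [sumSecondDeriv_convolution v hψ (hρ.of_le RandomSchrodinger.two_le_smooth) hc,
    kernelConvolution_apply, kernelConvolution_apply]
  rw [← h (fun t => ρ (x - t)) (hρ.comp (contDiff_const.sub contDiff_id))
    (hc.comp_homeomorph (Homeomorph.subLeft x))]
  simp only [sumSecondDeriv_comp_const_sub]

/-- The Caccioppoli type inequality for weak solutions. -/
theorem IsWeakNegSumSecondDeriv.abs_integral_mul_inner_I_le {ι : Type*} [Fintype ι]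
    {v : ι → E} {ψ g : E → ℂ} (h : IsWeakNegSumSecondDeriv μ v ψ g)
    (hψm : StronglyMeasurable ψ) (hψ : MemLp ψ 2 μ) (hgm : StronglyMeasurable g)
    (hg : ∀ r : ℝ, MemLp ((Metric.closedBall (0 : E) r).indicator g) 2 μ)
    {η ζ : E → ℝ} {r : ℝ} (hη : ContDiff ℝ 3 η) (hc : HasCompactSupport η)
    (hηr : ∀ x, r < ‖x‖ → η x = 0)
    {S : Set E} (hS : MeasurableSet S) (hηS : ∀ x ∉ S, fderiv ℝ η x = 0)
    (hζc : Continuous ζ) (hζr : ∀ x, r < ‖x‖ → ζ x = 0)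
    (hζ : ∀ x, ζ x = ∑ i, fderiv ℝ η x (v i) ^ 2)
    {M : ℝ} (hM : ∀ x ∈ S, |sumSecondDeriv v ζ x| ≤ M)
    (hM' : ∀ x ∉ S, sumSecondDeriv v ζ x = 0) :
    |∫ x, η x * ⟪Complex.I * ψ x, g x⟫ ∂μ| ≤
      (Fintype.card ι / 2 + M / 4 + 1 / 4) * ∫ x in S, ‖ψ x‖ ^ 2 ∂μ +
        1 / 4 * ∫ x, ζ x ^ 2 * ‖g x‖ ^ 2 ∂μ := by
  let φ : ℕ → ContDiffBump (0 : E) := fun n =>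
    ⟨1 / (n + 1) / 2, 1 / (n + 1), by positivity, by
      have : (0 : ℝ) < 1 / (n + 1) := by positivity
      linarith⟩
  have hφ : Tendsto (fun n => (φ n).rOut) atTop (𝓝 0) := tendsto_one_div_add_atTop_nhds_zero_nat
  -- `g` is only locally in `L²`. As the kernels have radius at most 1, truncating at `r + 1` does
  -- not alter its mollification where `‖x‖ ≤ r`, and `η`, `ζ` vanish elsewhere.
  let G : E → ℂ := (Metric.closedBall (0 : E) (r + 1)).indicator g
  have hGm : StronglyMeasurable G := hgm.indicator Metric.isClosed_closedBall.measurableSet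
  have hG : MemLp G 2 μ := hg _
  let u : ℕ → E → ℂ := fun n => kernelConvolution μ ψ ((φ n).normed μ)
  let w : ℕ → E → ℂ := fun n => kernelConvolution μ G ((φ n).normed μ)
  have hψl : LocallyIntegrable ψ μ := hψ.locallyIntegrable (by norm_num)
  have hGl : LocallyIntegrable G μ := hG.locallyIntegrable (by norm_num)
  have hul := ContDiffBump.tendsto_eLpNorm_convolution_sub hψm hψ hφ
  have hwl := ContDiffBump.tendsto_eLpNorm_convolution_sub hGm hG hφ
  obtain ⟨N₁, hN₁⟩ := eventually_atTop.1 (hul.eventually (gt_mem_nhds ENNReal.zero_lt_top))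
  obtain ⟨N₂, hN₂⟩ := eventually_atTop.1 (hwl.eventually (gt_mem_nhds ENNReal.zero_lt_top))
  -- Shifting by `N` discards the indices at which the mollifications might not be in `L²`.
  set N := max N₁ N₂
  have hud : ∀ n, ContDiff ℝ 2 (u n) := fun n =>
    ((φ n).hasCompactSupport_normed.contDiff_convolution_right _ hψl
      ((φ n).contDiff_normed (n := 2)))
  have hwd : ∀ n, Continuous (w n) := fun n =>
    ((φ n).hasCompactSupport_normed.continuous_convolution_right _ hGl (φ n).continuous_normed)
  have hu2 : ∀ n, MemLp (u (n + N)) 2 μ := fun n =>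
    memLp_of_eLpNorm_sub_lt_top (hud _).continuous.aestronglyMeasurable hψ
      (hN₁ _ ((le_max_left _ _).trans (Nat.le_add_left _ _)))
  have hw2 : ∀ n, MemLp (w (n + N)) 2 μ := fun n =>
    memLp_of_eLpNorm_sub_lt_top (hwd _).aestronglyMeasurable hG
      (hN₂ _ ((le_max_right _ _).trans (Nat.le_add_left _ _)))
  have hul' := hul.comp (tendsto_add_atTop_nat N)
  have hwl' := hwl.comp (tendsto_add_atTop_nat N)
  have hlap : ∀ n x, ‖x‖ ≤ r → sumSecondDeriv v (u n) x = -w n x := by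
    intro n x hx
    change sumSecondDeriv v (kernelConvolution μ ψ ((φ n).normed μ)) x = _
    rw [h.sumSecondDeriv_kernelConvolution hψl (φ n).contDiff_normed
      (φ n).hasCompactSupport_normed]
    simp only [w, kernelConvolution_apply]
    congr 2
    funext t
    by_cases ht : t ∈ Metric.closedBall (0 : E) (r + 1)
    · simp only [G, Set.indicator_of_mem ht]
    · have h1 : x - t ∉ Function.support ((φ n).normed μ) := by
        rw [(φ n).support_normed_eq, mem_ball_zero_iff, not_lt]
        have h2 : (φ n).rOut ≤ 1 := by
          change 1 / ((n : ℝ) + 1) ≤ 1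
          rw [div_le_one (by positivity)]
          linarith [n.cast_nonneg (α := ℝ)]
        rw [mem_closedBall_zero_iff, not_le] at ht
        have h3 := norm_sub_norm_le t x
        rw [norm_sub_rev] at h3
        linarith
      rw [Function.notMem_support.1 h1, zero_smul, zero_smul]
  have hineq : ∀ n, |∫ x, ⟪((η x : ℂ) * Complex.I) * u (n + N) x, w (n + N) x⟫ ∂μ| ≤
      (Fintype.card ι / 2 + M / 4 + 1 / 4) *
        ∫ x, ⟪S.indicator (fun _ => (1 : ℂ)) x * u (n + N) x, u (n + N) x⟫ ∂μ +
        1 / 4 * ∫ x, ⟪((ζ x : ℂ) ^ 2) * w (n + N) x, w (n + N) x⟫ ∂μ := by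
    intro n
    have h1 := abs_integral_mul_inner_I_sumSecondDeriv_le v (hud (n + N)) (hu2 n) hη hc hS hηS hζ
      hM hM'
    have e1 : ∫ x, η x * ⟪Complex.I * u (n + N) x, sumSecondDeriv v (u (n + N)) x⟫ ∂μ =
        -∫ x, ⟪((η x : ℂ) * Complex.I) * u (n + N) x, w (n + N) x⟫ ∂μ := by
      rw [← integral_neg]
      congr 1
      funext x
      by_cases hx : ‖x‖ ≤ r
      · rw [hlap _ _ hx, mul_assoc, ← Complex.real_smul, real_inner_smul_left, inner_neg_right]
        ring
      · simp [hηr x (not_le.1 hx)]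
    have e2 : ∫ x in S, ‖u (n + N) x‖ ^ 2 ∂μ =
        ∫ x, ⟪S.indicator (fun _ => (1 : ℂ)) x * u (n + N) x, u (n + N) x⟫ ∂μ := by
      rw [← integral_indicator hS]
      congr 1
      funext x
      by_cases hx : x ∈ S <;> simp [hx]
    have e3 : ∫ x, ζ x ^ 2 * ‖sumSecondDeriv v (u (n + N)) x‖ ^ 2 ∂μ =
        ∫ x, ⟪((ζ x : ℂ) ^ 2) * w (n + N) x, w (n + N) x⟫ ∂μ := by
      congr 1
      funext x
      by_cases hx : ‖x‖ ≤ r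
      · rw [hlap _ _ hx, norm_neg, ← Complex.ofReal_pow, ← Complex.real_smul,
          real_inner_smul_left, real_inner_self_eq_norm_sq]
      · simp [hζr x (not_le.1 hx)]
    rwa [e1, e2, e3, abs_neg] at h1
  obtain ⟨C₁, hC₁⟩ := hc.exists_bound_of_continuous hη.continuous
  have hζcs : HasCompactSupport ζ :=
    HasCompactSupport.intro (isCompact_closedBall (0 : E) r) fun x hx =>
      hζr x (by simpa using hx)
  obtain ⟨C₂, hC₂⟩ := hζcs.exists_bound_of_continuous hζc
  have hηm : Measurable η := hη.continuous.measurable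
  have hζm : Measurable ζ := hζc.measurable
  have l1 := tendsto_integral_inner_bounded_mul (m := fun x => (η x : ℂ) * Complex.I) (C := C₁)
    (by fun_prop) (fun x => by simpa using hC₁ x) hu2 hw2 hψ hG hul' hwl'
  have l2 := tendsto_integral_inner_bounded_mul (m := S.indicator (fun _ => (1 : ℂ))) (C := 1)
    (measurable_const.indicator hS)
    (fun x => by by_cases hx : x ∈ S <;> simp [hx]) hu2 hu2 hψ hψ hul' hul'
  have l3 := tendsto_integral_inner_bounded_mul (m := fun x => (ζ x : ℂ) ^ 2) (C := C₂ ^ 2)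
    (by fun_prop)
    (fun x => by
      rw [norm_pow, Complex.norm_real]
      exact pow_le_pow_left₀ (norm_nonneg _) (hC₂ x) 2) hw2 hw2 hG hG hwl' hwl'
  have hlim := le_of_tendsto_of_tendsto' l1.abs ((l2.const_mul _).add (l3.const_mul _)) hineq
  have hGx : ∀ x, ‖x‖ ≤ r → G x = g x := fun x hx =>
    Set.indicator_of_mem (by rw [mem_closedBall_zero_iff]; linarith) _
  have e1 : ∫ x, ⟪((η x : ℂ) * Complex.I) * ψ x, G x⟫ ∂μ =
      ∫ x, η x * ⟪Complex.I * ψ x, g x⟫ ∂μ := by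
    congr 1
    funext x
    by_cases hx : ‖x‖ ≤ r
    · rw [hGx _ hx, mul_assoc, ← Complex.real_smul, real_inner_smul_left]
    · simp [hηr x (not_le.1 hx)]
  have e2 : ∫ x, ⟪S.indicator (fun _ => (1 : ℂ)) x * ψ x, ψ x⟫ ∂μ = ∫ x in S, ‖ψ x‖ ^ 2 ∂μ := by
    rw [← integral_indicator hS]
    congr 1
    funext x
    by_cases hx : x ∈ S <;> simp [hx]
  have e3 : ∫ x, ⟪((ζ x : ℂ) ^ 2) * G x, G x⟫ ∂μ = ∫ x, ζ x ^ 2 * ‖g x‖ ^ 2 ∂μ := by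
    congr 1
    funext x
    by_cases hx : ‖x‖ ≤ r
    · rw [hGx _ hx, ← Complex.ofReal_pow, ← Complex.real_smul,
        real_inner_smul_left, real_inner_self_eq_norm_sq]
    · simp [hζr x (not_le.1 hx)]
  rwa [e1, e2, e3] at hlim

end WeakLaplacian

end

/-! ### Reality of the form under quadratic growth. -/

section

open scoped Topology ENNReal RealInnerProductSpace

section QuadraticGrowth

variable {E : Type*} [NormedAddCommGroup E] [NormedSpace ℝ E] [FiniteDimensional ℝ E]
  [MeasurableSpace E] [BorelSpace E] {μ : Measure E} [μ.IsAddHaarMeasure]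

/-- If `-Δψ + Vψ = φ` weakly, with `ψ, φ ∈ L²` and `V` real of at most quadratic growth, then
`⟪ψ, φ⟫` is real. -/
theorem IsWeakNegSumSecondDeriv.integral_inner_I_mul_eq_zero {ι : Type*} [Fintype ι]
    {v : ι → E} {ψ φ : E → ℂ} {V : E → ℝ} (hV : Measurable V) {C : ℝ} (hC0 : 0 ≤ C)
    (hC : ∀ x, |V x| ≤ C * (1 + ‖x‖ ^ 2))
    (hψm : StronglyMeasurable ψ) (hψ : MemLp ψ 2 μ)
    (hφm : StronglyMeasurable φ) (hφ : MemLp φ 2 μ)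
    (h : IsWeakNegSumSecondDeriv μ v ψ fun x => φ x - V x * ψ x) :
    ∫ x, ⟪Complex.I * ψ x, φ x⟫ ∂μ = 0 := by
  set g : E → ℂ := fun x => φ x - V x * ψ x with hgdef
  have hgm : StronglyMeasurable g :=
    (hφm.measurable.sub ((Complex.measurable_ofReal.comp hV).mul hψm.measurable)).stronglyMeasurable
  have hgle : ∀ x, ‖g x‖ ≤ ‖φ x‖ + C * (1 + ‖x‖ ^ 2) * ‖ψ x‖ := by
    intro x
    refine (norm_sub_le _ _).trans (add_le_add_right ?_ _)
    rw [norm_mul, Complex.norm_real]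
    exact mul_le_mul_of_nonneg_right (hC x) (norm_nonneg _)
  have hg : ∀ r : ℝ, MemLp ((Metric.closedBall (0 : E) r).indicator g) 2 μ := by
    intro r
    have h1 : MemLp (fun x => ‖φ x‖ + C * (1 + r ^ 2) * ‖ψ x‖) 2 μ :=
      hφ.norm.add (hψ.norm.const_mul _)
    refine h1.of_le (hgm.indicator Metric.isClosed_closedBall.measurableSet).aestronglyMeasurable
      (Eventually.of_forall fun x => ?_)
    by_cases hx : x ∈ Metric.closedBall (0 : E) r
    · rw [Set.indicator_of_mem hx]
      refine (hgle x).trans (le_trans ?_ (le_abs_self _))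
      rw [mem_closedBall_zero_iff] at hx
      gcongr
    · rw [Set.indicator_of_notMem hx, norm_zero]
      exact norm_nonneg _
  -- Reality of `V` removes it from the left side of the inequality; it survives only in `‖g‖` on
  -- the right.
  have hreal : ∀ x, ⟪Complex.I * ψ x, g x⟫ = ⟪Complex.I * ψ x, φ x⟫ := by
    intro x
    rw [hgdef]
    simp only [inner_sub_right]
    have : ⟪Complex.I * ψ x, (V x : ℂ) * ψ x⟫ = 0 := by
      simp [Complex.inner]
      ring
    rw [this, sub_zero]
  obtain ⟨D, hD0, hD⟩ := exists_cutoff v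
  have hR : ∀ n : ℕ, (1 : ℝ) ≤ n + 1 := fun n => by linarith [n.cast_nonneg (α := ℝ)]
  choose η ζ hη hηc hη0 hη1 hηone hηzero hηd hζc hζ hζle hζzero hLζ hLζ0 using
    fun n : ℕ => hD (n + 1) (hR n)
  let S : ℕ → Set E := fun n => {x | (n + 1 : ℝ) ≤ ‖x‖}
  have hSm : ∀ n, MeasurableSet (S n) := fun n => measurableSet_le measurable_const measurable_norm
  have hψsq : Integrable (fun x => ‖ψ x‖ ^ 2) μ := hψ.integrable_norm_pow two_ne_zero
  have hφsq : Integrable (fun x => ‖φ x‖ ^ 2) μ := hφ.integrable_norm_pow two_ne_zero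
  have hin : Integrable (fun x => ⟪Complex.I * ψ x, φ x⟫) μ := by
    have h1 : MemLp (fun x => Complex.I * ψ x) 2 μ := hψ.const_mul _
    refine (hψsq.add hφsq).mono' (h1.1.inner hφ.1) (Eventually.of_forall fun x => ?_)
    have h2 := abs_real_inner_le_norm (Complex.I * ψ x) (φ x)
    rw [norm_mul, Complex.norm_I, one_mul] at h2
    rw [Real.norm_eq_abs, Pi.add_apply]
    nlinarith [sq_nonneg (‖ψ x‖ - ‖φ x‖), sq_nonneg ‖ψ x‖, sq_nonneg ‖φ x‖]
  -- This dominates `D² (‖φ‖ + 5C‖ψ‖)²` by `(a + b)² ≤ 2a² + 2b²`; the 5 comes from `1 + (2R)² ≤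
  -- 5R²` for `R ≥ 1`.
  let K : E → ℝ := fun x => 2 * D ^ 2 * ‖φ x‖ ^ 2 + 50 * D ^ 2 * C ^ 2 * ‖ψ x‖ ^ 2
  have hK : Integrable K μ := (hφsq.const_mul _).add (hψsq.const_mul _)
  have hζ0 : ∀ n x, 0 ≤ ζ n x := fun n x => by rw [hζ]; positivity
  have hζS : ∀ n, ∀ x ∉ S n, ζ n x = 0 := by
    intro n x hx
    have hx' : ‖x‖ < n + 1 := not_le.1 hx
    simp [hζ, hηd n x hx']
  -- The decisive balance: on the shell, `ζ ≤ D / R²` cancels the factor `R²` from `V`, leaving a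
  -- bound independent of `n`.
  have hζg : ∀ n x, ζ n x ^ 2 * ‖g x‖ ^ 2 ≤ (S n).indicator K x := by
    intro n x
    by_cases hx : x ∈ S n
    · rw [Set.indicator_of_mem hx]
      have hx' : (n + 1 : ℝ) ≤ ‖x‖ := hx
      by_cases hx2 : 2 * (n + 1 : ℝ) < ‖x‖
      · rw [hζzero n x hx2, zero_pow two_ne_zero, zero_mul]
        simp only [K]
        positivity
      · rw [not_lt] at hx2
        set R : ℝ := n + 1
        have hR1 : 1 ≤ R := hR n
        have hR2 : 1 ≤ R ^ 2 := one_le_pow₀ hR1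
        have h1 : ‖g x‖ ≤ R ^ 2 * (‖φ x‖ + 5 * C * ‖ψ x‖) := by
          refine (hgle x).trans ?_
          have h2 : ‖x‖ ^ 2 ≤ (2 * R) ^ 2 := by gcongr
          have h3 : 1 + ‖x‖ ^ 2 ≤ 5 * R ^ 2 := by nlinarith
          have h4 : C * (1 + ‖x‖ ^ 2) * ‖ψ x‖ ≤ C * (5 * R ^ 2) * ‖ψ x‖ := by gcongr
          have h5 : ‖φ x‖ ≤ R ^ 2 * ‖φ x‖ := le_mul_of_one_le_left (norm_nonneg _) hR2
          linarith
        have h6 : ζ n x * ‖g x‖ ≤ D * (‖φ x‖ + 5 * C * ‖ψ x‖) := by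
          have hz : ζ n x ≤ D / R ^ 2 := hζle n x
          refine (mul_le_mul hz h1 (norm_nonneg _) (by positivity)).trans (le_of_eq ?_)
          have : R ≠ 0 := by positivity
          field_simp
        have h7 : (ζ n x * ‖g x‖) ^ 2 ≤ (D * (‖φ x‖ + 5 * C * ‖ψ x‖)) ^ 2 :=
          pow_le_pow_left₀ (mul_nonneg (hζ0 n x) (norm_nonneg _)) h6 2
        simp only [K]
        nlinarith [sq_nonneg (D * (‖φ x‖ - 5 * C * ‖ψ x‖))]
    · rw [Set.indicator_of_notMem hx, hζS n x hx]
      simp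
  have hmain : ∀ n, |∫ x, η n x * ⟪Complex.I * ψ x, φ x⟫ ∂μ| ≤
      (Fintype.card ι / 2 + D / 4 + 1 / 4) * ∫ x in S n, ‖ψ x‖ ^ 2 ∂μ +
        1 / 4 * ∫ x in S n, K x ∂μ := by
    intro n
    have h1 := h.abs_integral_mul_inner_I_le hψm hψ hgm hg (r := 2 * (n + 1)) (hη n) (hηc n)
      (fun x hx => hηzero n x hx.le) (hSm n) (fun x hx => hηd n x (not_le.1 hx)) (hζc n)
      (hζzero n) (hζ n) (M := D) (fun x _ => hLζ n x) (fun x hx => hLζ0 n x (not_le.1 hx))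
    simp only [hreal] at h1
    refine h1.trans (add_le_add_right (mul_le_mul_of_nonneg_left ?_ (by norm_num)) _)
    rw [← integral_indicator (hSm n)]
    exact integral_mono_of_nonneg (Eventually.of_forall fun x => by positivity)
      (hK.indicator (hSm n)) (Eventually.of_forall (hζg n))
  have hSlim : ∀ {F : E → ℝ}, Integrable F μ →
      Tendsto (fun n => ∫ x in S n, F x ∂μ) atTop (𝓝 0) := by
    intro F hF
    have h1 := tendsto_integral_of_dominated_convergence (μ := μ)
      (F := fun n => (S n).indicator F) (f := fun _ => (0 : ℝ)) (fun x => ‖F x‖)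
      (fun n => (hF.indicator (hSm n)).1) hF.norm
      (fun n => Eventually.of_forall fun x => norm_indicator_le_norm_self _ _)
      (Eventually.of_forall fun x => by
        refine tendsto_const_nhds.congr' ?_
        filter_upwards [eventually_ge_atTop ⌈‖x‖⌉₊] with n hn
        rw [Set.indicator_of_notMem]
        intro hx
        have hx' : (n + 1 : ℝ) ≤ ‖x‖ := hx
        have := Nat.ceil_le.1 hn
        linarith)
    simpa only [integral_indicator (hSm _), integral_zero] using h1
  have hηlim : Tendsto (fun n => ∫ x, η n x * ⟪Complex.I * ψ x, φ x⟫ ∂μ) atTop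
      (𝓝 (∫ x, ⟪Complex.I * ψ x, φ x⟫ ∂μ)) := by
    refine tendsto_integral_of_dominated_convergence (fun x => ‖⟪Complex.I * ψ x, φ x⟫‖)
      (fun n => (hη n).continuous.aestronglyMeasurable.mul hin.1) hin.norm
      (fun n => Eventually.of_forall fun x => ?_) (Eventually.of_forall fun x => ?_)
    · rw [norm_mul]
      refine mul_le_of_le_one_left (norm_nonneg _) ?_
      rw [Real.norm_of_nonneg (hη0 n x)]
      exact hη1 n x
    · refine tendsto_const_nhds.congr' ?_
      filter_upwards [eventually_ge_atTop ⌈‖x‖⌉₊] with n hn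
      rw [hηone n x ((Nat.ceil_le.1 hn).trans (by linarith)), one_mul]
  -- The right side consists of integrals of fixed integrable functions over sets escaping to
  -- infinity, so its limit is zero.
  have hlim := le_of_tendsto_of_tendsto' hηlim.abs
    (((hSlim hψsq).const_mul _).add ((hSlim hK).const_mul _)) hmain
  rw [mul_zero, mul_zero, add_zero] at hlim
  exact abs_nonpos_iff.1 hlim

end QuadraticGrowth

end

/-! ### Schrödinger operators on `C_c^∞`. -/

section

open scoped Topology ENNReal RealInnerProductSpace ComplexConjugate

namespace RandomSchrodinger

variable {d : ℕ}

theorem laplacian_eq_sumSecondDeriv {E F : Type*} [NormedAddCommGroup E] [InnerProductSpace ℝ E]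
    [FiniteDimensional ℝ E] [NormedAddCommGroup F] [NormedSpace ℝ F] {f : E → F}
    (hf : ContDiff ℝ 2 f) :
    Laplacian.laplacian f = sumSecondDeriv (stdOrthonormalBasis ℝ E) f := by
  rw [InnerProductSpace.laplacian_eq_iteratedFDeriv_stdOrthonormalBasis]
  funext x
  refine Finset.sum_congr rfl fun i _ => ?_
  have h1 : DifferentiableAt ℝ (fderiv ℝ f) x :=
    (hf.fderiv_right (m := 1) (by norm_num)).differentiable one_ne_zero x
  rw [iteratedFDeriv_two_apply, fderiv_clm_apply h1 (differentiableAt_const _)]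
  simp

theorem contDiff_two_ccInfty (f : CcInfty d) : ContDiff ℝ 2 f := f.contDiff.of_le two_le_smooth

/-- A smooth compactly supported function as an element of `C_c^∞(ℝ^d)`. -/
noncomputable def mkCcInfty (f : EuclideanSpace ℝ (Fin d) → ℂ) (hf : ContDiff ℝ (⊤ : ℕ∞) f)
    (hc : HasCompactSupport f) : CcInfty d := ⟨f, hf, hc, fun _ _ => trivial⟩

theorem inner_toLp {X : Type*} [MeasurableSpace X] {μ : Measure X} {f g : X → ℂ}
    (hf : MemLp f 2 μ) (hg : MemLp g 2 μ) :
    inner ℂ (hf.toLp f) (hg.toLp g) = ∫ x, conj (f x) * g x ∂μ := by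
  rw [L2.inner_def]
  apply integral_congr_ae
  filter_upwards [hf.coeFn_toLp, hg.coeFn_toLp] with x hx hy
  rw [hx, hy, RCLike.inner_apply, mul_comm]

/-- A vector orthogonal to all test functions vanishes almost everywhere; real-valued test functions
already suffice. -/
theorem dense_range_toL2 : Dense (LinearMap.range (toL2 d) : Set (L2 d)) := by
  rw [Submodule.dense_iff_topologicalClosure_eq_top,
    Submodule.topologicalClosure_eq_top_iff, Submodule.eq_bot_iff]
  intro ψ hψ
  rw [Submodule.mem_orthogonal] at hψ
  have hψ2 : MemLp ψ 2 volume := Lp.memLp ψ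
  have h0 : ∀ᵐ x, ψ x = 0 := by
    refine ae_eq_zero_of_integral_contDiff_smul_eq_zero (hψ2.locallyIntegrable (by norm_num))
      fun f hf hc => ?_
    let F : CcInfty d := mkCcInfty (fun x => (f x : ℂ)) (Complex.ofRealCLM.contDiff.comp hf)
      (hc.comp_left (g := fun r : ℝ => (r : ℂ)) Complex.ofReal_zero)
    have h1 := hψ (toL2 d F) (LinearMap.mem_range_self _ F)
    have h2 : inner ℂ (toL2 d F) ψ = ∫ x, conj (F x) * ψ x := by
      conv_lhs => rw [← Lp.toLp_coeFn ψ hψ2]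
      exact inner_toLp (memLp_ccInfty F) hψ2
    rw [h2] at h1
    rw [← h1]
    congr 1
    funext x
    change f x • ψ x = conj (f x : ℂ) * ψ x
    rw [Complex.conj_ofReal, Complex.real_smul]
  exact (Lp.eq_zero_iff_ae_eq_zero).2 h0

/-- Two integrations by parts in each direction; compact support of one factor removes the boundary
terms. -/
theorem integral_laplacian_mul {f g : EuclideanSpace ℝ (Fin d) → ℂ} (hf : ContDiff ℝ 2 f)
    (hfc : HasCompactSupport f) (hg : ContDiff ℝ 2 g) :
    ∫ x, Laplacian.laplacian f x * g x = ∫ x, f x * Laplacian.laplacian g x := by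
  rw [laplacian_eq_sumSecondDeriv hf, laplacian_eq_sumSecondDeriv hg]
  set v := stdOrthonormalBasis ℝ (EuclideanSpace ℝ (Fin d))
  have h1 : ∀ {h : EuclideanSpace ℝ (Fin d) → ℂ}, ContDiff ℝ 2 h → ∀ i,
      ContDiff ℝ 1 fun y => fderiv ℝ h y (v i) :=
    fun hh i => hh.fderiv_apply_const (by norm_num) (v i)
  have h2 : ∀ {h : EuclideanSpace ℝ (Fin d) → ℂ}, ContDiff ℝ 2 h → ∀ i,
      Continuous fun x => fderiv ℝ (fun y => fderiv ℝ h y (v i)) x (v i) :=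
    fun hh i => ((h1 hh i).fderiv_apply_const (m := 0) (by norm_num) (v i)).continuous
  have hc1 := fun i => hfc.fderiv_apply (𝕜 := ℝ) (v i)
  have hc2 := fun i => (hc1 i).fderiv_apply (𝕜 := ℝ) (v i)
  have hfd : ∀ x, DifferentiableAt ℝ f x := hf.differentiable two_ne_zero
  have hgd : ∀ x, DifferentiableAt ℝ g x := hg.differentiable two_ne_zero
  have I1 : ∀ i, Integrable
      (fun x => fderiv ℝ (fun y => fderiv ℝ f y (v i)) x (v i) * g x) := fun i =>
    ((h2 hf i).mul hg.continuous).integrable_of_hasCompactSupport (hc2 i).mul_right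
  have I2 : ∀ i, Integrable
      (fun x => f x * fderiv ℝ (fun y => fderiv ℝ g y (v i)) x (v i)) := fun i =>
    (hf.continuous.mul (h2 hg i)).integrable_of_hasCompactSupport hfc.mul_right
  have I3 : ∀ i, Integrable (fun x => fderiv ℝ f x (v i) * fderiv ℝ g x (v i)) := fun i =>
    ((h1 hf i).continuous.mul (h1 hg i).continuous).integrable_of_hasCompactSupport
      (hc1 i).mul_right
  have I4 : ∀ i, Integrable (fun x => fderiv ℝ f x (v i) * g x) := fun i =>
    ((h1 hf i).continuous.mul hg.continuous).integrable_of_hasCompactSupport (hc1 i).mul_right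
  have I5 : ∀ i, Integrable (fun x => f x * fderiv ℝ g x (v i)) := fun i =>
    (hf.continuous.mul (h1 hg i).continuous).integrable_of_hasCompactSupport hfc.mul_right
  simp only [sumSecondDeriv, Finset.sum_mul, Finset.mul_sum]
  rw [integral_finsetSum _ fun i _ => I1 i, integral_finsetSum _ fun i _ => I2 i]
  refine Finset.sum_congr rfl fun i _ => ?_
  have e1 := integral_mul_fderiv_eq_neg_fderiv_mul_of_integrable (𝕜 := ℂ) (μ := volume)
    (v := v i) (f := fun x => fderiv ℝ f x (v i)) (g := g) (I1 i) (I3 i) (I4 i)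
    (fun x _ => (h1 hf i).differentiable one_ne_zero x) (fun x _ => hgd x)
  have e2 := integral_mul_fderiv_eq_neg_fderiv_mul_of_integrable (𝕜 := ℂ) (μ := volume)
    (v := v i) (f := f) (g := fun x => fderiv ℝ g x (v i)) (I3 i) (I2 i) (I5 i)
    (fun x _ => hfd x) (fun x _ => (h1 hg i).differentiable one_ne_zero x)
  rw [e2, e1, neg_neg]

theorem laplacian_conj {f : EuclideanSpace ℝ (Fin d) → ℂ} (hf : ContDiff ℝ 2 f)
    (x : EuclideanSpace ℝ (Fin d)) :
    Laplacian.laplacian (fun y => conj (f y)) x = conj (Laplacian.laplacian f x) :=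
  hf.contDiffAt.laplacian_CLM_comp_left (l := Complex.conjCLE.toContinuousLinearMap)

theorem laplacian_ofReal {f : EuclideanSpace ℝ (Fin d) → ℝ} (hf : ContDiff ℝ 2 f)
    (x : EuclideanSpace ℝ (Fin d)) :
    Laplacian.laplacian (fun y => (f y : ℂ)) x = ((Laplacian.laplacian f x : ℝ) : ℂ) :=
  hf.contDiffAt.laplacian_CLM_comp_left (l := Complex.ofRealCLM)

variable {V : EuclideanSpace ℝ (Fin d) → ℝ}

/-- The real potential cancels between the two sides, and Green's identity for `conj f` and `g`
handles the rest. -/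
theorem isFormalAdjoint_schrodingerOp (hV : IsLocallyBoundedPotential V) :
    (schrodingerOp V hV).IsFormalAdjoint (schrodingerOp V hV) := by
  rintro ⟨_, f, rfl⟩ ⟨_, g, rfl⟩
  rw [schrodingerOp_apply, schrodingerOp_apply]
  have hf := contDiff_two_ccInfty f
  have hg := contDiff_two_ccInfty g
  have hfbar : ContDiff ℝ 2 fun x => conj (f x) := Complex.conjCLE.contDiff.comp hf
  have hfbarc : HasCompactSupport fun x => conj (f x) :=
    f.hasCompactSupport.comp_left (g := fun z : ℂ => conj z) (map_zero _)
  have hL : ∀ {h : EuclideanSpace ℝ (Fin d) → ℂ}, ContDiff ℝ 2 h →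
      Continuous (Laplacian.laplacian h) := fun hh => by
    rw [laplacian_eq_sumSecondDeriv hh]
    exact hh.continuous_sumSecondDeriv _
  have hLc : HasCompactSupport (Laplacian.laplacian fun x => conj (f x)) := by
    rw [laplacian_eq_sumSecondDeriv hfbar]
    exact hfbarc.sumSecondDeriv _
  change inner ℂ ((memLp_schrodingerFun hV f).toLp _) ((memLp_ccInfty g).toLp _) =
    inner ℂ ((memLp_ccInfty f).toLp _) ((memLp_schrodingerFun hV g).toLp _)
  rw [inner_toLp, inner_toLp]
  have e1 : ∀ x, conj (schrodingerFun V f x) * g x = conj (f x) * schrodingerFun V g x +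
      (conj (f x) * Laplacian.laplacian (g : EuclideanSpace ℝ (Fin d) → ℂ) x -
        Laplacian.laplacian (fun y => conj (f y)) x * g x) := by
    intro x
    rw [laplacian_conj hf]
    simp only [schrodingerFun, map_add, map_neg, map_mul, Complex.conj_ofReal]
    ring
  have i1 : Integrable (fun x => conj (f x) * schrodingerFun V g x) :=
    (memLp_ccInfty f).star.integrable_mul (memLp_schrodingerFun hV g)
  have i2 : Integrable (fun x =>
      conj (f x) * Laplacian.laplacian (g : EuclideanSpace ℝ (Fin d) → ℂ) x) :=
    (hfbar.continuous.mul (hL hg)).integrable_of_hasCompactSupport hfbarc.mul_right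
  have i3 : Integrable (fun x => Laplacian.laplacian (fun y => conj (f y)) x * g x) :=
    ((hL hfbar).mul hg.continuous).integrable_of_hasCompactSupport hLc.mul_right
  have i23 : Integrable (fun x =>
      conj (f x) * Laplacian.laplacian (g : EuclideanSpace ℝ (Fin d) → ℂ) x -
        Laplacian.laplacian (fun y => conj (f y)) x * g x) := i2.sub i3
  simp only [e1]
  rw [integral_add i1 i23, integral_sub i2 i3, integral_laplacian_mul hfbar hfbarc hg,
    sub_self, add_zero]

/-- `-Δ + V` is essentially self-adjoint on `C_c^∞(ℝ^d)` if `V` grows at most quadratically. -/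
theorem isEssentiallySelfAdjoint_schrodingerOp (hV : IsLocallyBoundedPotential V) {C : ℝ}
    (hC0 : 0 ≤ C) (hC : ∀ x, |V x| ≤ C * (1 + ‖x‖ ^ 2)) :
    (schrodingerOp V hV).IsEssentiallySelfAdjoint := by
  refine LinearPMap.isEssentiallySelfAdjoint_of_im_inner_eq_zero dense_range_toL2
    (isFormalAdjoint_schrodingerOp hV) fun ψ φ h => ?_
  have hψ : MemLp ψ 2 volume := Lp.memLp ψ
  have hφ : MemLp φ 2 volume := Lp.memLp φ
  -- Membership in the adjoint's graph, tested on real `f`, is the weak equation `-Δψ = φ - Vψ`.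
  have hweak : IsWeakNegSumSecondDeriv volume
      (stdOrthonormalBasis ℝ (EuclideanSpace ℝ (Fin d))) ψ fun x => φ x - V x * ψ x := by
    intro f hf hc
    have hf2 : ContDiff ℝ 2 f := hf.of_le two_le_smooth
    let F : CcInfty d := mkCcInfty (fun x => (f x : ℂ)) (Complex.ofRealCLM.contDiff.comp hf)
      (hc.comp_left (g := fun r : ℝ => (r : ℂ)) Complex.ofReal_zero)
    have h1 := h ⟨toL2 d F, LinearMap.mem_range_self (toL2 d) F⟩
    rw [schrodingerOp_apply] at h1
    change inner ℂ ((memLp_schrodingerFun hV F).toLp _) ψ =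
      inner ℂ ((memLp_ccInfty F).toLp _) φ at h1
    rw [← Lp.toLp_coeFn ψ hψ, ← Lp.toLp_coeFn φ hφ, inner_toLp, inner_toLp] at h1
    have hF : ∀ x, F x = (f x : ℂ) := fun x => rfl
    have hLF : ∀ x, schrodingerFun V F x =
        -((sumSecondDeriv (stdOrthonormalBasis ℝ (EuclideanSpace ℝ (Fin d))) f x : ℝ) : ℂ) +
          (V x : ℂ) * (f x : ℂ) := by
      intro x
      rw [← laplacian_eq_sumSecondDeriv hf2, ← laplacian_ofReal hf2]
      rfl
    have i1 : Integrable (fun x => conj (schrodingerFun V F x) * ψ x) :=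
      (memLp_schrodingerFun hV F).star.integrable_mul hψ
    have i2 : Integrable (fun x => conj (F x) * φ x) :=
      (memLp_ccInfty F).star.integrable_mul hφ
    have i3 : Integrable (fun x =>
        sumSecondDeriv (stdOrthonormalBasis ℝ (EuclideanSpace ℝ (Fin d))) f x • ψ x) := by
      have hm : MemLp (sumSecondDeriv (stdOrthonormalBasis ℝ (EuclideanSpace ℝ (Fin d))) f)
          2 volume :=
        (hf2.continuous_sumSecondDeriv _).memLp_of_hasCompactSupport (hc.sumSecondDeriv _)
      exact memLp_one_iff_integrable.1 (hψ.smul (p := 2) (q := 2) (r := 1) hm)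
    -- Three integrable pieces: the first two have equal integrals by `h1`, so only the `Δf` term
    -- remains.
    have e1 : ∀ x, f x • (φ x - V x * ψ x) = (conj (F x) * φ x -
        conj (schrodingerFun V F x) * ψ x) -
        sumSecondDeriv (stdOrthonormalBasis ℝ (EuclideanSpace ℝ (Fin d))) f x • ψ x := by
      intro x
      rw [hLF, hF]
      simp only [map_add, map_neg, map_mul, Complex.conj_ofReal, Complex.real_smul]
      ring
    have i21 : Integrable (fun x => conj (F x) * φ x - conj (schrodingerFun V F x) * ψ x) :=
      i2.sub i1
    simp only [e1]
    rw [integral_sub i21 i3, integral_sub i2 i1, h1]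
    simp
  have h2 := hweak.integral_inner_I_mul_eq_zero hV.1 hC0 hC (Lp.stronglyMeasurable ψ) hψ
    (Lp.stronglyMeasurable φ) hφ
  have i1 : Integrable (fun x => conj (ψ x) * φ x) := hψ.star.integrable_mul hφ
  -- The real inner product of `iψ` with `φ` is the imaginary part of `conj ψ * φ`.
  rw [← Lp.toLp_coeFn ψ hψ, ← Lp.toLp_coeFn φ hφ, inner_toLp, ← h2]
  refine (integral_im i1).symm.trans ?_
  congr 1
  funext x
  simp [Complex.inner]
  ring

end RandomSchrodinger

end

/-! ### Almost sure essential self-adjointness. -/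

theorem lemma2 {d : ℕ} (hd : 0 < d) {α δ : ℝ} (hα : 0 < α) (hδ : 0 < δ)
    (hαδ : (d : ℝ) < (2 + α) * δ)
    (a : (Fin d → ℤ) → ℝ) (ha_nonneg : ∀ n, 0 ≤ a n)
    (ha : a =O[Bornology.cobounded (Fin d → ℤ)] fun n => ‖n‖ ^ (-α))
    (μ : Measure ℝ) (hμ : RandomSchrodinger.HasTailDensity δ μ)
    {Ω : Type*} [MeasurableSpace Ω] (P : Measure Ω) [IsProbabilityMeasure P]
    (ω : (Fin d → ℤ) → Ω → ℝ) (hω : ∀ n, Measurable (ω n))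
    (hω_indep : iIndepFun ω P) (hω_law : ∀ n, P.map (ω n) = μ) :
    ∀ᵐ θ ∂P, (RandomSchrodinger.hamiltonian a fun n => ω n θ).IsEssentiallySelfAdjoint := by
  filter_upwards [RandomSchrodinger.ae_exists_abs_mul_le hα hδ hαδ a ha μ hμ P ω hω hω_law]
    with θ hθ
  obtain ⟨C, hC0, hC⟩ := RandomSchrodinger.exists_abs_potential_le hθ
  exact RandomSchrodinger.isEssentiallySelfAdjoint_schrodingerOp _ hC0 hC
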